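/- Let $\mathcal M$ be a $C^*$-algebra, and let $\mathbb E$ be a product system over $\mathbb N_0^k$: $C^*$-correspondences $E_1,\dots,E_k$ over $\mathcal M$ (with essential left actions), together with isomorphisms of correspondences $t_{i,j}:E_i\otimes E_j\to E_j\otimes E_i$ such that $t_{i,i}=\mathrm{id}$ and $t_{i,j}=t_{j,i}^{-1}$. Let $(\sigma,T^{(1)},\dots,T^{(k)})$ be a completely bounded covariant representation of $\mathbb E$ on a Hilbert space $\mathcal H$. That is, $\sigma:\mathcal M\to B(\mathcal H)$ is an essential representation; each $T^{(i)}:E_i\to B(\mathcal H)$ is linear and completely bounded and satisfies $T^{(i)}(a\xi b)=\sigma(a)T^{(i)}(\xi)\sigma(b)$; and the bounded operators $\widetilde T^{(i)}:E_i\otimes_\sigma\mathcal H\to\mathcal H$, $\widetilde T^{(i)}(\xi\otimes h)=T^{(i)}(\xi)h$, satisfy $$\widetilde T^{(i)}(I_{E_i}\otimes\widetilde T^{(j)})=\widetilde T^{(j)}(I_{E_j}\otimes\widetilde T^{(i)})(t_{i,j}\otimes I_{\mathcal H})\qquad(1\le i,j\le k).$$ Assume that the representation is doubly commuting: $$\widetilde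 T^{(j)*}\widetilde T^{(i)}=(I_{E_j}\otimes\widetilde T^{(i)})(t_{i,j}\otimes I_{\mathcal H})(I_{E_i}\otimes\widetilde T^{(j)*})\qquad(i\ne j).$$ For a sequence $\alpha=(\alpha_1,\dots,\alpha_n)$ of distinct elements of $\{1,\dots,k\}$, for $\mathbf m\in\mathbb N_0^n$ and for a closed $\sigma(\mathcal M)$-invariant subspace $\mathcal W\subseteq\mathcal H$, let $\mathfrak L^\alpha_{\mathbf m}(\mathcal W)$ be the closed linear span of the vectors $$T^{(\alpha_1)}(\xi_{1,1})\cdots T^{(\alpha_1)}(\xi_{1,m_1})\cdots T^{(\alpha_n)}(\xi_{n,1})\cdots T^{(\alpha_n)}(\xi_{n,m_n})\,h\qquad(\xi_{j,l}\in E_{\alpha_j},\ h\in\mathcal W).$$ Call $\mathcal W$ wandering for $(\sigma,T^{(\alpha_1)},\dots,T^{(\alpha_n)})$ if $\mathcal W\perp\mathfrak L^\alpha_{\mathbf m}(\mathcal W)$ for all $\mathbf m\ne0$, and generating wandering if moreover the closed linear span $\bigvee_{\mathbf m}\mathfrak L^\alpha_{\mathbf m}(\mathcal W)$ is the whole space;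 the representation $(\sigma,T^{(\alpha_1)},\dots,T^{(\alpha_n)})$ has the generating wandering subspace property if such a $\mathcal W$ exists. A closed subspace $\mathcal K\subseteq\mathcal H$ is $(\sigma,T^{(i)})$-reducing if it is $\sigma(\mathcal M)$-invariant and both $\mathcal K$ and $\mathcal K^\perp$ are invariant under all $T^{(i)}(\xi)$, $\xi\in E_i$. Assume that for each $i\in\{1,\dots,k\}$ and each $(\sigma,T^{(i)})$-reducing subspace $\mathcal K_i$, the subspace $\mathcal K_i\ominus\widetilde T^{(i)}(E_i\otimes\mathcal K_i)$ is a generating wandering subspace for the restriction $(\sigma,T^{(i)})|_{\mathcal K_i}$. Then for every nonempty $\alpha=\{\alpha_1,\dots,\alpha_n\}\subseteq\{1,\dots,k\}$, enumerated in any order without repetition, the representation $(\sigma,T^{(\alpha_1)},\dots,T^{(\alpha_n)})$ has the generating wandering subspace property. Moreover, a generating wandering subspace for it is $$\mathcal W_\alpha=\bigcap_{j=1}^n\bigl(\mathcal H\ominus\widetilde T^{(\alpha_j)}(E_{\alpha_j}\otimes\mathcal H)\bigr)=\bigcap_{j=1}^n\ker\widetilde T^{(\alpha_j)*}.$$ 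-/

import Mathlib

open scoped TensorProduct ComplexOrder
open MulOpposite

universe u v w

set_option linter.unusedSectionVars false

/-- A `C*`-correspondence over `M`: a (right) Hilbert `M`-module with an essential left action `φ`
of `M` by adjointable operators. Right Hilbert `M`-modules are encoded as `CStarModule`s over the
opposite algebra `Mᵐᵒᵖ`, so that `⟨x, y a⟩ = ⟨x, y⟩ a` in `M`; see `ip`, `ra` and `ip_ra_right`. -/
structure CStarCorr (M : Type u) [NonUnitalCStarAlgebra M] [PartialOrder M]
    [StarOrderedRing M] where
  carrier : Type v
  [normed : NormedAddCommGroup carrier]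
  [space : NormedSpace ℂ carrier]
  [complete : CompleteSpace carrier]
  [ract : SMul Mᵐᵒᵖ carrier]
  [hilbert : CStarModule Mᵐᵒᵖ carrier]
  φ : M →ₙₐ[ℂ] (carrier →L[ℂ] carrier)
  φ_adjoint : ∀ (a : M) (x y : carrier), inner Mᵐᵒᵖ (φ a x) y = inner Mᵐᵒᵖ x (φ (star a) y)
  φ_essential : (Submodule.span ℂ {z | ∃ (a : M) (x : carrier), φ a x = z}).topologicalClosure = ⊤

namespace CStarCorr

instance {M : Type u} [NonUnitalCStarAlgebra M] [PartialOrder M] [StarOrderedRing M] :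
    CoeSort (CStarCorr.{u, v} M) (Type v) := ⟨CStarCorr.carrier⟩

attribute [instance] CStarCorr.normed CStarCorr.space CStarCorr.complete CStarCorr.ract
  CStarCorr.hilbert

variable {M : Type u} [NonUnitalCStarAlgebra M] [PartialOrder M] [StarOrderedRing M]

/-- The `M`-valued inner product, conjugate linear in the first variable. -/
def ip (X : CStarCorr.{u, v} M) (x y : X) : M := unop (inner Mᵐᵒᵖ x y)

/-- The right action of `M`. -/
def ra (X : CStarCorr.{u, v} M) (x : X) (a : M) : X := op a • x

section
variable (X : CStarCorr.{u, v} M) (x y z : X) (a : M) (c : ℂ)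

lemma ip_add_right : X.ip x (y + z) = X.ip x y + X.ip x z := by simp [ip]
lemma ip_add_left : X.ip (x + y) z = X.ip x z + X.ip y z := by simp [ip]
lemma ip_sub_right : X.ip x (y - z) = X.ip x y - X.ip x z := by simp [ip]
lemma ip_sub_left : X.ip (x - y) z = X.ip x z - X.ip y z := by simp [ip]
lemma ip_smul_right : X.ip x (c • y) = c • X.ip x y := by simp [ip]
lemma ip_smul_left : X.ip (c • x) y = star c • X.ip x y := by simp [ip]
lemma star_ip : star (X.ip x y) = X.ip y x := by simp [ip, ← unop_star]
lemma ip_ra_right : X.ip x (X.ra y a) = X.ip x y * a := by simp [ip, ra]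
lemma ip_ra_left : X.ip (X.ra x a) y = star a * X.ip x y := by simp [ip, ra]
lemma ip_self_nonneg : 0 ≤ X.ip x x := CStarModule.inner_self_nonneg (A := Mᵐᵒᵖ) (x := x)
lemma ip_sum_right {ι : Type*} (s : Finset ι) (f : ι → X) :
    X.ip x (∑ i ∈ s, f i) = ∑ i ∈ s, X.ip x (f i) := by simp [ip]
lemma ip_sum_left {ι : Type*} (s : Finset ι) (f : ι → X) :
    X.ip (∑ i ∈ s, f i) x = ∑ i ∈ s, X.ip (f i) x := by simp [ip]
lemma norm_sq : ‖x‖ ^ 2 = ‖X.ip x x‖ := by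
  rw [CStarModule.norm_sq_eq Mᵐᵒᵖ]; rfl
lemma norm_ip_le : ‖X.ip x y‖ ≤ ‖x‖ * ‖y‖ := CStarModule.norm_inner_le (A := Mᵐᵒᵖ) X
lemma ip_φ : X.ip (X.φ a x) y = X.ip x (X.φ (star a) y) := congrArg unop (X.φ_adjoint a x y)
lemma ext_ip {x y : X} (h : ∀ z, X.ip z x = X.ip z y) : x = y := by
  rw [← sub_eq_zero, ← CStarModule.inner_self (A := Mᵐᵒᵖ)]
  have := h (x - y)
  apply unop_injective
  change X.ip _ _ = 0
  rw [ip_sub_right, this, sub_self]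
lemma φ_ra (b : M) : X.φ a (X.ra x b) = X.ra (X.φ a x) b := by
  apply X.ext_ip; intro z
  have h (p q : X) : X.ip p (X.φ a q) = X.ip (X.φ (star a) p) q := by simp [ip_φ]
  simp [h, ip_ra_right]
end

section abstract_cstar
variable {D : Type*} [NonUnitalCStarAlgebra D] [PartialOrder D] [StarOrderedRing D]

lemma exists_factor {x : D} (hx : 0 ≤ x) : ∃ y : D, x = star y * y :=
  CStarAlgebra.nonneg_iff_eq_star_mul_self.mp hx

lemma exists_negPart {x : D} (hsa : IsSelfAdjoint x) :
    ∃ n : D, 0 ≤ n * n * n ∧ star n * x * n = -(n * n * n) ∧ (n * n * n = 0 → 0 ≤ x) := by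
  have hneg : 0 ≤ x⁻ := CFC.negPart_nonneg x
  have hnsa : star x⁻ = x⁻ := (IsSelfAdjoint.of_nonneg hneg)
  have hdec : x⁺ - x⁻ = x := CFC.posPart_sub_negPart x hsa
  refine ⟨x⁻, ?_, ?_, fun h0 => ?_⟩
  · have := star_left_conjugate_nonneg hneg x⁻
    rwa [hnsa] at this
  · rw [hnsa]
    have : x⁻ * x = -(x⁻ * x⁻) := by
      conv_lhs => rw [← hdec, mul_sub, hdec]
      simp
    rw [this, neg_mul]
  · have h4 : x⁻ * x⁻ = 0 := by
      rw [← CStarRing.star_mul_self_eq_zero_iff, star_mul, hnsa, ← mul_assoc, h0, zero_mul]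
    have h5 : x⁻ = 0 := by
      rw [← CStarRing.star_mul_self_eq_zero_iff, hnsa, h4]
    rw [← hdec, h5, sub_zero]
    exact CFC.posPart_nonneg x
end abstract_cstar

/-- The Gram matrix `(⟨ξ i, ξ j⟩)` with entries in `M`. -/
def gram (X : CStarCorr.{u, v} M) {n : ℕ} (ξ : Fin n → X) : CStarMatrix (Fin n) (Fin n) M :=
  CStarMatrix.ofMatrix fun i j => X.ip (ξ i) (ξ j)

lemma gram_apply (X : CStarCorr.{u, v} M) {n : ℕ} (ξ : Fin n → X) (i j : Fin n) :
    X.gram ξ i j = X.ip (ξ i) (ξ j) := rfl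

lemma star_mul_self_apply {n : ℕ} (y : CStarMatrix (Fin n) (Fin n) M) (i j : Fin n) :
    (star y * y) i j = ∑ k, star (y k i) * y k j := rfl

/-- The row `ξ b`. -/
def rowMul (X : CStarCorr.{u, v} M) {n : ℕ} (ξ : Fin n → X) (b : CStarMatrix (Fin n) (Fin n) M) :
    Fin n → X := fun j => ∑ i, X.ra (ξ i) (b i j)

lemma gram_rowMul (X : CStarCorr.{u, v} M) {n : ℕ} (ξ : Fin n → X)
    (b : CStarMatrix (Fin n) (Fin n) M) : X.gram (X.rowMul ξ b) = star b * X.gram ξ * b := by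
  ext i j
  simp only [gram_apply, rowMul, CStarMatrix.mul_apply,
    CStarMatrix.star_apply, ip_sum_left, ip_sum_right, ip_ra_left, ip_ra_right, Finset.sum_mul]

lemma diag_nonneg {n : ℕ} {P : CStarMatrix (Fin n) (Fin n) M} (hP : 0 ≤ P) (l : Fin n) :
    0 ≤ P l l := by
  obtain ⟨z, rfl⟩ := exists_factor hP
  rw [star_mul_self_apply]
  exact Finset.sum_nonneg fun k _ => star_mul_self_nonneg (z k l)

lemma eq_zero_of_diag {n : ℕ} {P : CStarMatrix (Fin n) (Fin n) M} (hP : 0 ≤ P)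
    (h : ∀ l, P l l = 0) : P = 0 := by
  obtain ⟨z, rfl⟩ := exists_factor hP
  have hz : z = 0 := by
    ext k l
    have := h l
    rw [star_mul_self_apply, Finset.sum_eq_zero_iff_of_nonneg
      (fun k _ => star_mul_self_nonneg (z k l))] at this
    exact (CStarRing.star_mul_self_eq_zero_iff _).mp (this k (Finset.mem_univ k))
  simp [hz]

lemma gram_selfAdjoint (X : CStarCorr.{u, v} M) {n : ℕ} (ξ : Fin n → X) :
    IsSelfAdjoint (X.gram ξ) := by
  ext i j
  exact X.star_ip _ _

/-- Gram matrices are positive. -/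
lemma gram_nonneg (X : CStarCorr.{u, v} M) {n : ℕ} (ξ : Fin n → X) : 0 ≤ X.gram ξ := by
  obtain ⟨m, h1, h2, h3⟩ := exists_negPart (X.gram_selfAdjoint ξ)
  refine h3 (eq_zero_of_diag h1 fun l => le_antisymm ?_ (diag_nonneg h1 l))
  have h4 : 0 ≤ X.gram (X.rowMul ξ m) l l := X.ip_self_nonneg _
  rw [gram_rowMul, h2] at h4
  exact neg_nonneg.mp h4


/-- An adjointable action of `M` on a space with a positive `B`-valued form is contractive. -/
lemma action_le {B V : Type*} [NonUnitalCStarAlgebra B] [PartialOrder B] [StarOrderedRing B]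
    [AddCommGroup V] [Module ℂ V] (S : V →ₗ⋆[ℂ] V →ₗ[ℂ] B) (A : M →ₙₐ[ℂ] Module.End ℂ V)
    (h0 : ∀ v, 0 ≤ S v v) (hA : ∀ a v w, S (A a v) w = S v (A (star a) w)) (a : M) (v : V) :
    S (A a v) (A a v) ≤ (‖a‖ ^ 2 : ℂ) • S v v := by
  have key := CStarAlgebra.star_mul_le_algebraMap_norm_sq (a := (a : Unitization ℂ M))
  rw [← sub_nonneg] at key
  obtain ⟨d, hd⟩ := CStarAlgebra.nonneg_iff_eq_star_mul_self.mp key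
  have h1 : (‖a‖ ^ 2 : ℂ) = star d.fst * d.fst := by
    have := congrArg (fun z : Unitization ℂ M => z.fst) hd
    simpa [Unitization.norm_inr, Algebra.algebraMap_eq_smul_one, sub_eq_add_neg] using this
  have h2 : -(star a * a) = star d.fst • d.snd + d.fst • star d.snd + star d.snd * d.snd := by
    have := congrArg (fun z : Unitization ℂ M => z.snd) hd
    simpa [Unitization.norm_inr, Algebra.algebraMap_eq_smul_one, sub_eq_add_neg] using this
  have h3 := h0 (d.fst • v + A d.snd v)
  rw [← sub_nonneg]
  convert h3 using 1
  have e1 := congrArg (fun m => S v (A m v)) h2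
  simp only [map_neg, map_add, map_mul, map_smul, LinearMap.neg_apply, LinearMap.add_apply,
    LinearMap.smul_apply, Module.End.mul_apply, hA, map_smulₛₗ,
    starRingEnd_apply, smul_add, smul_smul] at e1 ⊢
  rw [sub_eq_add_neg, e1, h1, mul_comm]
  abel

section form
variable (X : CStarCorr.{u, v} M) {B : Type*} [NonUnitalCStarAlgebra B]
  {F : Type*} [AddCommGroup F] [Module ℂ F]
  (s : F →ₗ⋆[ℂ] F →ₗ[ℂ] B) (π : M →ₙₐ[ℂ] Module.End ℂ F)

/-- The sesquilinear form `⟨e ⊗ f, e' ⊗ f'⟩ = s(f, π(⟨e, e'⟩) f')` on the algebraic tensor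
product, for a `B`-valued form `s` on `F` and an action `π` of `M` on `F`. -/
noncomputable def form : X ⊗[ℂ] F →ₗ⋆[ℂ] X ⊗[ℂ] F →ₗ[ℂ] B :=
  TensorProduct.lift <| LinearMap.mk₂'ₛₗ (starRingEnd ℂ) (starRingEnd ℂ)
    (fun e f => TensorProduct.lift <| LinearMap.mk₂ ℂ (fun e' f' => s f (π (X.ip e e') f'))
      (by intros; simp [ip_add_right]) (by intros; simp [ip_smul_right])
      (by intros; simp) (by intros; simp))
    (by intros; ext; simp [ip_add_left]) (by intros; ext; simp [ip_smul_left])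
    (by intros; ext; simp) (by intros; ext; simp)

@[simp] lemma form_tmul (e e' : X) (f f' : F) :
    X.form s π (e ⊗ₜ f) (e' ⊗ₜ f') = s f (π (X.ip e e') f') := rfl

variable {s π}

lemma star_form (hs : ∀ f g, star (s f g) = s g f)
    (hπ : ∀ a f g, s (π a f) g = s f (π (star a) g)) (v w : X ⊗[ℂ] F) :
    star (X.form s π v w) = X.form s π w v := by
  induction v with
  | zero => simp
  | add v v' hv hv' => simp [hv, hv']
  | tmul e f =>
    induction w with
    | zero => simp
    | add v v' hv hv' => simp [hv, hv']
    | tmul e' f' => simp [hs, hπ, star_ip]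

lemma form_sum {n : ℕ} (hπ : ∀ a f g, s (π a f) g = s f (π (star a) g)) (e : Fin n → X)
    (f : Fin n → F) {y : CStarMatrix (Fin n) (Fin n) M} (hy : X.gram e = star y * y) :
    X.form s π (∑ i, e i ⊗ₜ f i) (∑ i, e i ⊗ₜ f i) =
      ∑ k, s (∑ j, π (y k j) (f j)) (∑ j, π (y k j) (f j)) := by
  have h (i j) : X.ip (e i) (e j) = ∑ k, star (y k i) * y k j :=
    congrFun (congrFun hy i) j
  simp only [map_sum, LinearMap.sum_apply, form_tmul, h, hπ, map_mul, Module.End.mul_apply]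
  rw [Finset.sum_comm_cycle]

lemma form_self_eq (hπ : ∀ a f g, s (π a f) g = s f (π (star a) g)) (v : X ⊗[ℂ] F) :
    ∃ (n : ℕ) (g : Fin n → F), X.form s π v v = ∑ k, s (g k) (g k) := by
  obtain ⟨n, e, f, rfl⟩ := TensorProduct.exists_sum_tmul_eq v
  obtain ⟨y, hy⟩ := exists_factor (X.gram_nonneg e)
  exact ⟨n, _, X.form_sum hπ e f hy⟩

lemma form_nonneg [PartialOrder B] [StarOrderedRing B] (h0 : ∀ f, 0 ≤ s f f)
    (hπ : ∀ a f g, s (π a f) g = s f (π (star a) g)) (v : X ⊗[ℂ] F) : 0 ≤ X.form s π v v := by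
  obtain ⟨n, g, h⟩ := X.form_self_eq hπ v
  rw [h]
  exact Finset.sum_nonneg fun k _ => h0 _

/-- The algebraic left action `a (e ⊗ f) = φ(a) e ⊗ f`. -/
noncomputable def lact (F : Type*) [AddCommGroup F] [Module ℂ F] :
    M →ₙₐ[ℂ] Module.End ℂ (X ⊗[ℂ] F) where
  toFun a := LinearMap.rTensor F (X.φ a : X →ₗ[ℂ] X)
  map_smul' c a := by ext; simp [TensorProduct.smul_tmul']
  map_zero' := by ext; simp
  map_add' a b := by ext; simp
  map_mul' a b := by ext; simp

@[simp] lemma lact_tmul (F : Type*) [AddCommGroup F] [Module ℂ F] (a : M) (e : X) (f : F) :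
    X.lact F a (e ⊗ₜ f) = X.φ a e ⊗ₜ f := rfl

lemma form_lact (a : M) (v w : X ⊗[ℂ] F) :
    X.form s π (X.lact F a v) w = X.form s π v (X.lact F (star a) w) := by
  induction v with
  | zero => simp
  | add v v' hv hv' => simp [hv, hv']
  | tmul e f =>
    induction w with
    | zero => simp
    | add v v' hv hv' => simp only [map_add, hv, hv']
    | tmul e' f' => simp [ip_φ]

end form

/-- A homomorphism into bounded operators, viewed as acting by linear endomorphisms. -/
def endHom {V : Type*} [SeminormedAddCommGroup V] [NormedSpace ℂ V]
    (ρ : M →ₙₐ[ℂ] (V →L[ℂ] V)) : M →ₙₐ[ℂ] Module.End ℂ V where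
  toFun a := (ρ a : V →ₗ[ℂ] V)
  map_smul' c a := by ext; simp
  map_zero' := by ext; simp
  map_add' a b := by ext; simp
  map_mul' a b := by ext; simp

section hilbert
variable (X : CStarCorr.{u, v} M) {H : Type w} [NormedAddCommGroup H] [InnerProductSpace ℂ H]
  [CompleteSpace H] (σ : M →⋆ₙₐ[ℂ] (H →L[ℂ] H))

lemma inner_self_nonneg' (f : H) : (0 : ℂ) ≤ innerₛₗ ℂ f f := by
  rw [innerₛₗ_apply_apply, inner_self_eq_norm_sq_to_K]
  norm_cast
  positivity

lemma inner_rep (a : M) (f g : H) : inner ℂ (σ a f) g = inner ℂ f (σ (star a) g) := by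
  rw [map_star, ContinuousLinearMap.star_eq_adjoint, ContinuousLinearMap.adjoint_inner_right]

/-- The algebraic tensor product of `X` and `H`, to be equipped with the semi-inner product
induced by `σ`. -/
def PreHT (_σ : M →⋆ₙₐ[ℂ] (H →L[ℂ] H)) : Type (max v w) := X ⊗[ℂ] H

noncomputable instance : AddCommGroup (X.PreHT σ) := inferInstanceAs (AddCommGroup (X ⊗[ℂ] H))
noncomputable instance : Module ℂ (X.PreHT σ) := inferInstanceAs (Module ℂ (X ⊗[ℂ] H))

/-- The `σ`-balanced form `⟨ξ ⊗ h, ξ' ⊗ h'⟩ = ⟨h, σ(⟨ξ, ξ'⟩) h'⟩`. -/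
noncomputable def hform : X ⊗[ℂ] H →ₗ⋆[ℂ] X ⊗[ℂ] H →ₗ[ℂ] ℂ :=
  X.form (innerₛₗ ℂ) (endHom (σ : M →ₙₐ[ℂ] (H →L[ℂ] H)))

noncomputable instance preCore : PreInnerProductSpace.Core ℂ (X.PreHT σ) where
  inner v w := X.hform σ v w
  conj_inner_symm v w := X.star_form (fun f g => inner_conj_symm g f) (inner_rep σ) w v
  re_inner_nonneg v := (Complex.nonneg_iff.mp (X.form_nonneg (B := ℂ)
    inner_self_nonneg' (inner_rep σ) v)).1
  add_left u v w := LinearMap.map_add₂ (X.hform σ) u v w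
  smul_left v w c := LinearMap.map_smulₛₗ₂ (X.hform σ) c v w

noncomputable instance : SeminormedAddCommGroup (X.PreHT σ) :=
  InnerProductSpace.Core.toSeminormedAddCommGroup (𝕜 := ℂ)
noncomputable instance : InnerProductSpace ℂ (X.PreHT σ) := InnerProductSpace.ofCore _

/-- The Hilbert space `X ⊗_σ H`. -/
abbrev HT : Type (max v w) := UniformSpace.Completion (X.PreHT σ)

/-- The canonical map from the algebraic tensor product. -/
noncomputable def ι : X ⊗[ℂ] H →ₗ[ℂ] X.HT σ :=
  (UniformSpace.Completion.toComplL : X.PreHT σ →L[ℂ] X.HT σ).toLinearMap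

/-- The elementary tensor `ξ ⊗ h` in `X ⊗_σ H`. -/
noncomputable def tmul (ξ : X) (h : H) : X.HT σ := X.ι σ (ξ ⊗ₜ h)

lemma denseRange_ι : DenseRange (X.ι σ) :=
  UniformSpace.Completion.denseRange_coe (α := X.PreHT σ)

lemma inner_ι (v w : X ⊗[ℂ] H) : inner ℂ (X.ι σ v) (X.ι σ w) = X.hform σ v w :=
  UniformSpace.Completion.inner_coe (𝕜 := ℂ) (E := X.PreHT σ) v w

lemma norm_ι_sq (v : X ⊗[ℂ] H) : (‖X.ι σ v‖ ^ 2 : ℂ) = X.hform σ v v := by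
  rw [← inner_ι, inner_self_eq_norm_sq_to_K]; rfl

lemma inner_tmul (ξ η : X) (h g : H) :
    inner ℂ (X.tmul σ ξ h) (X.tmul σ η g) = inner ℂ h (σ (X.ip ξ η) g) := X.inner_ι σ _ _

variable {X σ} in
lemma HT_ext {K : Type*} [NormedAddCommGroup K] [NormedSpace ℂ K] {A B : X.HT σ →L[ℂ] K}
    (h : ∀ ξ g, A (X.tmul σ ξ g) = B (X.tmul σ ξ g)) : A = B := by
  apply ContinuousLinearMap.coeFn_injective
  refine (X.denseRange_ι σ).equalizer A.continuous B.continuous ?_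
  have : A.toLinearMap ∘ₗ X.ι σ = B.toLinearMap ∘ₗ X.ι σ := TensorProduct.ext' h
  ext v
  exact LinearMap.congr_fun this v

lemma norm_lact_le (a : M) (v : X ⊗[ℂ] H) :
    ‖(X.ι σ ∘ₗ X.lact H a) v‖ ≤ ‖a‖ * ‖X.ι σ v‖ := by
  have h := action_le (B := ℂ) (X.hform σ) (X.lact H)
    (X.form_nonneg inner_self_nonneg' (inner_rep σ)) (X.form_lact) a v
  rw [← norm_ι_sq, ← norm_ι_sq, smul_eq_mul] at h
  norm_cast at h
  rw [← mul_pow] at h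
  exact le_of_sq_le_sq h (by positivity)

lemma extend_lact (a : M) (ξ : X) (h : H) :
    (X.ι σ ∘ₗ X.lact H a).extendOfNorm (X.ι σ) (X.tmul σ ξ h) = X.tmul σ (X.φ a ξ) h :=
  LinearMap.extendOfNorm_eq (X.denseRange_ι σ) ⟨_, X.norm_lact_le σ a⟩ _

lemma tmul_add_left (ξ η : X) (h : H) : X.tmul σ (ξ + η) h = X.tmul σ ξ h + X.tmul σ η h := by
  simp [tmul, TensorProduct.add_tmul]
lemma tmul_smul_left (c : ℂ) (ξ : X) (h : H) : X.tmul σ (c • ξ) h = c • X.tmul σ ξ h := by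
  simp [tmul, ← TensorProduct.smul_tmul']
lemma tmul_add_right (ξ : X) (h g : H) : X.tmul σ ξ (h + g) = X.tmul σ ξ h + X.tmul σ ξ g := by
  simp [tmul, TensorProduct.tmul_add]
lemma tmul_smul_right (c : ℂ) (ξ : X) (h : H) : X.tmul σ ξ (c • h) = c • X.tmul σ ξ h := by
  simp [tmul]

/-- The induced representation `a ↦ φ(a) ⊗ I_H` of `M` on `X ⊗_σ H`. -/
noncomputable def indRep : M →⋆ₙₐ[ℂ] (X.HT σ →L[ℂ] X.HT σ) where
  toFun a := (X.ι σ ∘ₗ X.lact H a).extendOfNorm (X.ι σ)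
  map_smul' c a := HT_ext fun ξ h => by
    simp only [extend_lact, smul_apply, MonoidHom.id_apply]
    simp [tmul_smul_left]
  map_zero' := HT_ext fun ξ h => by
    rw [extend_lact]; simp [tmul]
  map_add' a b := HT_ext fun ξ h => by
    simp only [extend_lact, add_apply]
    simp [tmul_add_left]
  map_mul' a b := HT_ext fun ξ h => by
    simp only [extend_lact, mul_apply_eq_comp]
    simp
  map_star' a := by
    rw [ContinuousLinearMap.star_eq_adjoint]
    refine HT_ext fun ξ h => ?_
    refine ext_inner_left ℂ fun z => ?_
    rw [ContinuousLinearMap.adjoint_inner_right, extend_lact]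
    refine (X.denseRange_ι σ).induction_on z (isClosed_eq (by fun_prop) (by fun_prop)) fun v => ?_
    have h2 : (X.ι σ ∘ₗ X.lact H a).extendOfNorm (X.ι σ) (X.ι σ v) = X.ι σ (X.lact H a v) :=
      LinearMap.extendOfNorm_eq (X.denseRange_ι σ) ⟨_, X.norm_lact_le σ a⟩ _
    rw [h2]
    simp only [tmul, inner_ι, hform, form_lact, lact_tmul]

@[simp] lemma indRep_tmul (a : M) (ξ : X) (h : H) :
    X.indRep σ a (X.tmul σ ξ h) = X.tmul σ (X.φ a ξ) h := X.extend_lact σ a ξ h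

end hilbert

section idTensor
variable (X : CStarCorr.{u, v} M) {H K : Type*} [NormedAddCommGroup H] [InnerProductSpace ℂ H]
  [CompleteSpace H] [NormedAddCommGroup K] [InnerProductSpace ℂ K] [CompleteSpace K]
  {σ : M →⋆ₙₐ[ℂ] (H →L[ℂ] H)} {τ : M →⋆ₙₐ[ℂ] (K →L[ℂ] K)}

lemma norm_ι_sum_sq {n : ℕ} (e : Fin n → X)
    (f : Fin n → H) {y : CStarMatrix (Fin n) (Fin n) M} (hy : X.gram e = star y * y) :
    ‖X.ι σ (∑ i, e i ⊗ₜ f i)‖ ^ 2 = ∑ k, ‖∑ j, σ (y k j) (f j)‖ ^ 2 := by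
  have h := X.form_sum (B := ℂ) (s := innerₛₗ ℂ)
    (π := endHom (σ : M →ₙₐ[ℂ] (H →L[ℂ] H))) (inner_rep σ) e f hy
  change X.hform σ _ _ = ∑ k, innerₛₗ ℂ (∑ j, σ (y k j) (f j)) (∑ j, σ (y k j) (f j)) at h
  rw [← norm_ι_sq] at h
  simp only [innerₛₗ_apply_apply, inner_self_eq_norm_sq_to_K] at h
  apply Complex.ofReal_injective
  push_cast
  exact h

lemma norm_lTensor_le (S : H →L[ℂ] K) (hS : ∀ a h, S (σ a h) = τ a (S h)) (v : X ⊗[ℂ] H) :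
    ‖(X.ι τ ∘ₗ LinearMap.lTensor X (S : H →ₗ[ℂ] K)) v‖ ≤ ‖S‖ * ‖X.ι σ v‖ := by
  obtain ⟨n, e, f, rfl⟩ := TensorProduct.exists_sum_tmul_eq v
  obtain ⟨y, hy⟩ := exists_factor (X.gram_nonneg e)
  refine le_of_sq_le_sq ?_ (by positivity)
  rw [mul_pow, norm_ι_sum_sq X e f hy]
  simp only [LinearMap.comp_apply, map_sum, LinearMap.lTensor_tmul]
  rw [← map_sum, norm_ι_sum_sq X e _ hy, Finset.mul_sum]
  refine Finset.sum_le_sum fun k _ => ?_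
  rw [← mul_pow]
  gcongr
  simp only [ContinuousLinearMap.coe_coe, ← hS, ← map_sum]
  exact S.le_opNorm _

/-- The operator `I_X ⊗ S : X ⊗_σ H → X ⊗_τ K`, for an operator `S : H → K` that intertwines
`σ` and `τ`. -/
noncomputable def idTensor (S : H →L[ℂ] K) (_hS : ∀ a h, S (σ a h) = τ a (S h)) :
    X.HT σ →L[ℂ] X.HT τ :=
  (X.ι τ ∘ₗ LinearMap.lTensor X (S : H →ₗ[ℂ] K)).extendOfNorm (X.ι σ)

@[simp] lemma idTensor_tmul (S : H →L[ℂ] K) (hS : ∀ a h, S (σ a h) = τ a (S h)) (ξ : X) (h : H) :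
    X.idTensor S hS (X.tmul σ ξ h) = X.tmul τ ξ (S h) :=
  LinearMap.extendOfNorm_eq (X.denseRange_ι σ) ⟨_, X.norm_lTensor_le S hS⟩ _
end idTensor

section moduleTensor
variable (X Y : CStarCorr.{u, v} M)

/-- The algebraic tensor product of `X` and `Y`, to be equipped with its `M`-valued
semi-inner product. -/
def PreMT : Type v := X ⊗[ℂ] Y

noncomputable instance : AddCommGroup (X.PreMT Y) := inferInstanceAs (AddCommGroup (X ⊗[ℂ] Y))
noncomputable instance : Module ℂ (X.PreMT Y) := inferInstanceAs (Module ℂ (X ⊗[ℂ] Y))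

/-- The inner product of `Y` as a sesquilinear map. -/
def ipₛₗ : Y →ₗ⋆[ℂ] Y →ₗ[ℂ] M :=
  LinearMap.mk₂'ₛₗ (starRingEnd ℂ) (RingHom.id ℂ) Y.ip
    (fun _ _ _ => Y.ip_add_left _ _ _) (fun _ _ _ => Y.ip_smul_left _ _ _)
    (fun _ _ _ => Y.ip_add_right _ _ _) (fun _ _ _ => Y.ip_smul_right _ _ _)

/-- The form `⟨ξ ⊗ η, ξ' ⊗ η'⟩ = ⟨η, φ(⟨ξ, ξ'⟩) η'⟩`. -/
noncomputable def mform : X.PreMT Y →ₗ⋆[ℂ] X.PreMT Y →ₗ[ℂ] M := X.form Y.ipₛₗ (endHom Y.φ)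

lemma mform_nonneg (v : X.PreMT Y) : 0 ≤ X.mform Y v v :=
  X.form_nonneg Y.ip_self_nonneg (fun a f g => Y.ip_φ f g a) v

lemma star_mform (v w : X.PreMT Y) : star (X.mform Y v w) = X.mform Y w v :=
  X.star_form Y.star_ip (fun a f g => Y.ip_φ f g a) v w

/-- The algebraic right action `(ξ ⊗ η) a = ξ ⊗ (η a)`. -/
noncomputable def mra (a : M) : X.PreMT Y →ₗ[ℂ] X.PreMT Y :=
  LinearMap.lTensor X
    { toFun := fun y => Y.ra y a
      map_add' := fun y z => Y.ext_ip fun x => by simp [ip_ra_right, ip_add_right, add_mul]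
      map_smul' := fun c y => Y.ext_ip fun x => by
        simp [ip_ra_right, ip_smul_right, smul_mul_assoc] }

/-- The algebraic left action on `X ⊗ Y`. -/
noncomputable def mlact : M →ₙₐ[ℂ] Module.End ℂ (X.PreMT Y) := X.lact Y

lemma mform_mlact (a : M) (v w : X.PreMT Y) :
    X.mform Y (X.mlact Y a v) w = X.mform Y v (X.mlact Y (star a) w) := X.form_lact a v w

lemma mform_mra (v w : X.PreMT Y) (a : M) : X.mform Y v (X.mra Y a w) = X.mform Y v w * a := by
  change X ⊗[ℂ] Y at v w
  change X.form Y.ipₛₗ (endHom Y.φ) v (LinearMap.lTensor X _ w) =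
    X.form Y.ipₛₗ (endHom Y.φ) v w * a
  induction v with
  | zero => simp
  | add v v' hv hv' => simp only [map_add, LinearMap.add_apply, hv, hv', add_mul]
  | tmul e f =>
    induction w with
    | zero => simp
    | add v v' hv hv' => simp only [map_add, hv, hv', add_mul]
    | tmul e' f' =>
      change Y.ip f (Y.φ (X.ip e e') (Y.ra f' a)) = Y.ip f (Y.φ (X.ip e e') f') * a
      rw [φ_ra, ip_ra_right]

lemma mform_mra_left (v w : X.PreMT Y) (a : M) :
    X.mform Y (X.mra Y a v) w = star a * X.mform Y v w := by
  rw [← star_mform, mform_mra, star_mul, star_mform]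

/-- Cauchy–Schwarz for the semi-inner product. -/
lemma norm_mform_le (v w : X.PreMT Y) :
    ‖X.mform Y v w‖ ^ 2 ≤ ‖X.mform Y v v‖ * ‖X.mform Y w w‖ := by
  set c := X.mform Y v w with hc
  have main : ∀ k : ℝ, ‖X.mform Y v v‖ < k → ‖c‖ ^ 2 ≤ k * ‖X.mform Y w w‖ := by
    intro k hk
    have hk0 : 0 < k := (norm_nonneg _).trans_lt hk
    have h1 := X.mform_nonneg Y ((k : ℂ) • w - X.mra Y c v)
    simp only [map_sub, LinearMap.sub_apply, map_smul, map_smulₛₗ, LinearMap.smul_apply,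
      mform_mra, mform_mra_left] at h1
    have hcs : star c = X.mform Y w v := X.star_mform Y v w
    rw [← hc, ← hcs, Complex.conj_ofReal] at h1
    have h2 : star c * X.mform Y v v * c ≤ (k : ℝ) • (star c * c) := by
      refine (CStarAlgebra.star_left_conjugate_le_norm_smul
        (X.mform_nonneg Y v).isSelfAdjoint).trans ?_
      exact smul_le_smul_of_nonneg_right hk.le (star_mul_self_nonneg c)
    have h3 : k • (star c * c) ≤ k • (k • X.mform Y w w) := by
      rw [← sub_nonneg]
      have h4 := add_nonneg h1 (sub_nonneg.mpr h2)
      convert h4 using 1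
      simp only [Complex.coe_smul, smul_sub, mul_assoc]
      abel
    have h5 : star c * c ≤ k • X.mform Y w w := (smul_le_smul_iff_of_pos_left hk0).mp h3
    have h6 := CStarAlgebra.norm_le_norm_of_nonneg_of_le (star_mul_self_nonneg c) h5
    rwa [CStarRing.norm_star_mul_self, norm_smul, Real.norm_of_nonneg hk0.le, ← sq] at h6
  have ht : Filter.Tendsto (fun k : ℝ => k * ‖X.mform Y w w‖)
      (nhdsWithin ‖X.mform Y v v‖ (Set.Ioi ‖X.mform Y v v‖))
      (nhds (‖X.mform Y v v‖ * ‖X.mform Y w w‖)) :=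
    ((continuous_id.mul continuous_const).tendsto _).mono_left nhdsWithin_le_nhds
  exact ge_of_tendsto ht (eventually_mem_nhdsWithin.mono main)

lemma preMT_core : letI : Norm (X.PreMT Y) := ⟨fun v => √‖X.mform Y v v‖⟩
    SeminormedSpace.Core ℂ (X.PreMT Y) :=
  letI : Norm (X.PreMT Y) := ⟨fun v => √‖X.mform Y v v‖⟩
  { norm_nonneg := fun v => Real.sqrt_nonneg _
    norm_smul := fun c v => by
      change √‖X.mform Y (c • v) (c • v)‖ = ‖c‖ * √‖X.mform Y v v‖
      simp [norm_smul, ← mul_assoc]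
    norm_triangle := fun v w => by
      change √‖X.mform Y (v + w) (v + w)‖ ≤ √‖X.mform Y v v‖ + √‖X.mform Y w w‖
      apply Real.sqrt_le_iff.mpr ⟨by positivity, ?_⟩
      have hvw : ‖X.mform Y v w‖ ≤ √‖X.mform Y v v‖ * √‖X.mform Y w w‖ := by
        rw [← Real.sqrt_mul (norm_nonneg _)]
        exact Real.le_sqrt_of_sq_le (X.norm_mform_le Y v w)
      have hwv : ‖X.mform Y w v‖ ≤ √‖X.mform Y v v‖ * √‖X.mform Y w w‖ := by
        rwa [← star_mform, norm_star]
      simp only [map_add, LinearMap.add_apply]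
      have h1 := norm_add_le (X.mform Y v v + X.mform Y w v) (X.mform Y v w + X.mform Y w w)
      have h2 := norm_add_le (X.mform Y v v) (X.mform Y w v)
      have h3 := norm_add_le (X.mform Y v w) (X.mform Y w w)
      have h4 := Real.sq_sqrt (norm_nonneg (X.mform Y v v))
      have h5 := Real.sq_sqrt (norm_nonneg (X.mform Y w w))
      nlinarith }

noncomputable instance : Norm (X.PreMT Y) := ⟨fun v => √‖X.mform Y v v‖⟩
noncomputable instance : SeminormedAddCommGroup (X.PreMT Y) :=
  .ofCore (X.preMT_core Y)
noncomputable instance : NormedSpace ℂ (X.PreMT Y) where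
  norm_smul_le c v := ((X.preMT_core Y).norm_smul c v).le
noncomputable instance : Inner Mᵐᵒᵖ (X.PreMT Y) := ⟨fun v w => op (X.mform Y v w)⟩

lemma preMT_norm (v : X.PreMT Y) : ‖v‖ = √‖X.mform Y v v‖ := rfl
lemma preMT_norm_sq (v : X.PreMT Y) : ‖v‖ ^ 2 = ‖X.mform Y v v‖ := Real.sq_sqrt (norm_nonneg _)

lemma norm_mform_le' (v w : X.PreMT Y) : ‖X.mform Y v w‖ ≤ ‖v‖ * ‖w‖ := by
  refine le_of_sq_le_sq ?_ (by positivity)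
  rw [mul_pow, preMT_norm_sq, preMT_norm_sq]
  exact X.norm_mform_le Y v w

/-- The underlying Banach space of the tensor product `X ⊗ Y` of correspondences. -/
abbrev MT : Type v := UniformSpace.Completion (X.PreMT Y)

/-- The inner product as a continuous sesquilinear map. -/
noncomputable def mformL : X.PreMT Y →L⋆[ℂ] X.PreMT Y →L[ℂ] M :=
  LinearMap.mkContinuous₂ (X.mform Y) 1 fun v w => by simpa using X.norm_mform_le' Y v w

lemma mt_continuous_pre : Continuous fun p : X.PreMT Y × X.PreMT Y => inner Mᵐᵒᵖ p.1 p.2 := by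
  change Continuous fun p : X.PreMT Y × X.PreMT Y => op (X.mformL Y p.1 p.2)
  fun_prop

@[simp] lemma mt_inner_coe (v w : X.PreMT Y) :
    inner Mᵐᵒᵖ (v : X.MT Y) (w : X.MT Y) = op (X.mform Y v w) :=
  (UniformSpace.Completion.isDenseInducing_coe.prodMap
    UniformSpace.Completion.isDenseInducing_coe).extend_eq (X.mt_continuous_pre Y) (v, w)

lemma mt_continuous_inner : Continuous fun p : X.MT Y × X.MT Y => inner Mᵐᵒᵖ p.1 p.2 := by
  let inner' : X.PreMT Y →+ X.PreMT Y →+ Mᵐᵒᵖ :=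
    { toFun := fun x =>
        { toFun := fun y => op (X.mform Y x y)
          map_zero' := by simp
          map_add' := by simp }
      map_zero' := by ext; simp
      map_add' := fun x y => by ext; simp }
  exact (UniformSpace.Completion.isDenseInducing_toCompl (X.PreMT Y)).extend_Z_bilin
    (φ := inner') (UniformSpace.Completion.isDenseInducing_toCompl (X.PreMT Y))
    (X.mt_continuous_pre Y)

lemma mt_cont {α : Type*} [TopologicalSpace α] {f g : α → X.MT Y} (hf : Continuous f)
    (hg : Continuous g) : Continuous fun x => inner Mᵐᵒᵖ (f x) (g x) :=
  (X.mt_continuous_inner Y).comp (hf.prodMk hg)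

/-- The canonical map from the algebraic tensor product. -/
noncomputable def mι : X.PreMT Y →L[ℂ] X.MT Y := UniformSpace.Completion.toComplL

lemma mι_eq (v : X.PreMT Y) : X.mι Y v = (v : X.MT Y) := rfl

lemma denseRange_mι : DenseRange (X.mι Y) := UniformSpace.Completion.denseRange_coe

lemma norm_mra_le (a : M) (v : X.PreMT Y) :
    ‖((X.mι Y).toLinearMap ∘ₗ X.mra Y a) v‖ ≤ ‖a‖ * ‖(X.mι Y).toLinearMap v‖ := by
  change ‖((X.mra Y a v : X.PreMT Y) : X.MT Y)‖ ≤ ‖a‖ * ‖(v : X.MT Y)‖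
  rw [UniformSpace.Completion.norm_coe, UniformSpace.Completion.norm_coe]
  refine le_of_sq_le_sq ?_ (by positivity)
  rw [mul_pow, preMT_norm_sq, preMT_norm_sq, mform_mra, mform_mra_left]
  refine (norm_mul_le _ _).trans ((mul_le_mul_of_nonneg_right (norm_mul_le _ _)
    (norm_nonneg _)).trans_eq ?_)
  rw [norm_star]; ring

lemma norm_mlact_le (a : M) (v : X.PreMT Y) :
    ‖((X.mι Y).toLinearMap ∘ₗ X.mlact Y a) v‖ ≤ ‖a‖ * ‖(X.mι Y).toLinearMap v‖ := by
  change ‖((X.mlact Y a v : X.PreMT Y) : X.MT Y)‖ ≤ ‖a‖ * ‖(v : X.MT Y)‖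
  rw [UniformSpace.Completion.norm_coe, UniformSpace.Completion.norm_coe]
  refine le_of_sq_le_sq ?_ (by positivity)
  have h := action_le (X.mform Y) (X.mlact Y) (X.mform_nonneg Y) (X.mform_mlact Y) a v
  have h2 := CStarAlgebra.norm_le_norm_of_nonneg_of_le (X.mform_nonneg Y _) h
  rw [mul_pow, preMT_norm_sq, preMT_norm_sq]
  refine h2.trans_eq ?_
  rw [norm_smul]; simp

/-- The right action of `M` on `X ⊗ Y`. -/
noncomputable instance : SMul Mᵐᵒᵖ (X.MT Y) where
  smul a := ((X.mι Y).toLinearMap ∘ₗ X.mra Y (unop a)).extendOfNorm (X.mι Y).toLinearMap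

@[simp] lemma mt_smul_coe (a : Mᵐᵒᵖ) (v : X.PreMT Y) :
    a • (v : X.MT Y) = ((X.mra Y (unop a) v : X.PreMT Y) : X.MT Y) :=
  LinearMap.extendOfNorm_eq (X.denseRange_mι Y) ⟨_, X.norm_mra_le Y (unop a)⟩ v

lemma mt_smul_cont (a : Mᵐᵒᵖ) : Continuous fun v : X.MT Y => a • v :=
  (((X.mι Y).toLinearMap ∘ₗ X.mra Y (unop a)).extendOfNorm (X.mι Y).toLinearMap).continuous

noncomputable instance : CStarModule Mᵐᵒᵖ (X.MT Y) where
  inner_add_right {x y z} := by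
    refine UniformSpace.Completion.induction_on₃ x y z ?_ fun x y z => ?_
    · refine isClosed_eq (X.mt_cont Y ?_ ?_) (.add (X.mt_cont Y ?_ ?_) (X.mt_cont Y ?_ ?_)) <;>
        fun_prop
    · simp only [← UniformSpace.Completion.coe_add, mt_inner_coe, map_add, op_add]
  inner_self_nonneg {x} := by
    refine UniformSpace.Completion.induction_on x ?_ fun x => ?_
    · exact CStarAlgebra.isClosed_nonneg.preimage (X.mt_cont Y continuous_id continuous_id)
    · rw [mt_inner_coe]; exact X.mform_nonneg Y x
  inner_self {x} := by
    have h : ‖x‖ ^ 2 = ‖inner Mᵐᵒᵖ x x‖ := by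
      refine UniformSpace.Completion.induction_on x ?_ fun x => ?_
      · exact isClosed_eq (by fun_prop) (X.mt_cont Y continuous_id continuous_id).norm
      · rw [mt_inner_coe, UniformSpace.Completion.norm_coe, preMT_norm_sq, norm_op]
    rw [← norm_eq_zero, ← h]; simp
  inner_op_smul_right {a x y} := by
    refine UniformSpace.Completion.induction_on₂ x y ?_ fun x y => ?_
    · exact isClosed_eq (X.mt_cont Y continuous_fst ((X.mt_smul_cont Y a).comp continuous_snd))
        (continuous_const.mul (X.mt_cont Y continuous_fst continuous_snd))
    · rw [mt_smul_coe, mt_inner_coe, mt_inner_coe, mform_mra]; simp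
  inner_smul_right_complex {c x y} := by
    refine UniformSpace.Completion.induction_on₂ x y ?_ fun x y => ?_
    · exact isClosed_eq (X.mt_cont Y continuous_fst (continuous_snd.const_smul c))
        ((X.mt_cont Y continuous_fst continuous_snd).const_smul c)
    · rw [← UniformSpace.Completion.coe_smul, mt_inner_coe, mt_inner_coe, map_smul, op_smul]
  star_inner x y := by
    refine UniformSpace.Completion.induction_on₂ x y ?_ fun x y => ?_
    · exact isClosed_eq (X.mt_cont Y continuous_fst continuous_snd).star
        (X.mt_cont Y continuous_snd continuous_fst)
    · rw [mt_inner_coe, mt_inner_coe, ← op_star, star_mform]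
  norm_eq_sqrt_norm_inner_self x := by
    refine UniformSpace.Completion.induction_on x ?_ fun x => ?_
    · exact isClosed_eq (by fun_prop) (X.mt_cont Y continuous_id continuous_id).norm.sqrt
    · rw [mt_inner_coe, UniformSpace.Completion.norm_coe, norm_op, preMT_norm]

/-- The elementary tensor `ξ ⊗ η`. -/
noncomputable def mtmul (ξ : X) (η : Y) : X.MT Y := X.mι Y (show X.PreMT Y from ξ ⊗ₜ[ℂ] η)

lemma extend_mlact (a : M) (v : X.PreMT Y) :
    ((X.mι Y).toLinearMap ∘ₗ X.mlact Y a).extendOfNorm (X.mι Y).toLinearMap (X.mι Y v) =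
      X.mι Y (X.mlact Y a v) :=
  LinearMap.extendOfNorm_eq (X.denseRange_mι Y) ⟨_, X.norm_mlact_le Y a⟩ v

lemma mι_induction {K : Type*} [NormedAddCommGroup K] [NormedSpace ℂ K] {A B : X.MT Y →L[ℂ] K}
    (h : ∀ v, A (X.mι Y v) = B (X.mι Y v)) : A = B := by
  apply ContinuousLinearMap.coeFn_injective
  exact (X.denseRange_mι Y).equalizer A.continuous B.continuous (funext h)

lemma norm_φ_le (X : CStarCorr.{u, v} M) (a : M) (x : X) : ‖X.φ a x‖ ≤ ‖a‖ * ‖x‖ := by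
  refine le_of_sq_le_sq ?_ (by positivity)
  have h := action_le X.ipₛₗ (endHom X.φ) X.ip_self_nonneg (fun a f g => X.ip_φ f g a) a x
  have h2 := CStarAlgebra.norm_le_norm_of_nonneg_of_le (X.ip_self_nonneg _) h
  rw [mul_pow, norm_sq, norm_sq]
  refine h2.trans_eq ?_
  rw [norm_smul]
  simp [ipₛₗ]

lemma norm_mtmul_le (ξ : X) (η : Y) : ‖X.mtmul Y ξ η‖ ≤ ‖ξ‖ * ‖η‖ := by
  refine le_of_sq_le_sq ?_ (by positivity)
  have h : ‖X.mtmul Y ξ η‖ = ‖(show X.PreMT Y from ξ ⊗ₜ[ℂ] η)‖ :=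
    UniformSpace.Completion.norm_coe _
  rw [h, preMT_norm_sq]
  change ‖Y.ip η (Y.φ (X.ip ξ ξ) η)‖ ≤ _
  calc _ ≤ ‖η‖ * (‖X.ip ξ ξ‖ * ‖η‖) := (Y.norm_ip_le _ _).trans
        (mul_le_mul_of_nonneg_left (Y.norm_φ_le _ _) (norm_nonneg _))
    _ = _ := by rw [← norm_sq]; ring

/-- The left action of `M` on `X ⊗ Y`. -/
noncomputable def mφ : M →ₙₐ[ℂ] (X.MT Y →L[ℂ] X.MT Y) where
  toFun a := ((X.mι Y).toLinearMap ∘ₗ X.mlact Y a).extendOfNorm (X.mι Y).toLinearMap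
  map_smul' c a := X.mι_induction Y fun v => by
    simp only [extend_mlact, smul_apply, MonoidHom.id_apply]
    simp
  map_zero' := X.mι_induction Y fun v => by
    rw [extend_mlact]; simp
  map_add' a b := X.mι_induction Y fun v => by
    simp only [extend_mlact, add_apply]
    simp
  map_mul' a b := X.mι_induction Y fun v => by
    simp only [extend_mlact, mul_apply_eq_comp]
    simp

/-- The tensor product `X ⊗ Y` of correspondences. -/
noncomputable def tensor : CStarCorr.{u, v} M where
  carrier := X.MT Y
  φ := X.mφ Y
  φ_adjoint a x y := by
    refine UniformSpace.Completion.induction_on₂ x y ?_ fun x y => ?_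
    · exact isClosed_eq (X.mt_cont Y ((X.mφ Y a).continuous.comp continuous_fst) continuous_snd)
        (X.mt_cont Y continuous_fst ((X.mφ Y (star a)).continuous.comp continuous_snd))
    · have h (b : M) (v : X.PreMT Y) : X.mφ Y b (v : X.MT Y) = X.mι Y (X.mlact Y b v) :=
        X.extend_mlact Y b v
      rw [h, h, mι_eq, mι_eq, mt_inner_coe, mt_inner_coe, mform_mlact]
  φ_essential := by
    set S := Submodule.span ℂ {z | ∃ (a : M) (x : X.MT Y), X.mφ Y a x = z} with hS
    have key (ξ : X) (η : Y) : X.mtmul Y ξ η ∈ S.topologicalClosure := by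
      let L : X →L[ℂ] X.MT Y := LinearMap.mkContinuous
        ((X.mι Y).toLinearMap ∘ₗ (TensorProduct.mk ℂ X Y).flip η) ‖η‖
        fun ξ => (X.norm_mtmul_le Y ξ η).trans_eq (mul_comm _ _)
      have h : (⊤ : Submodule ℂ X) ≤ S.topologicalClosure.comap L.toLinearMap := by
        rw [← X.φ_essential]
        refine Submodule.topologicalClosure_minimal _ (Submodule.span_le.mpr ?_)
          (S.isClosed_topologicalClosure.preimage L.continuous)
        rintro _ ⟨a, x, rfl⟩
        exact S.le_topologicalClosure (Submodule.subset_span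
          ⟨a, X.mtmul Y x η, X.extend_mlact Y a _⟩)
      exact h (Submodule.mem_top (x := ξ))
    refine eq_top_iff.mpr fun x _ => ?_
    refine UniformSpace.Completion.induction_on x S.isClosed_topologicalClosure fun v => ?_
    change X.mι Y v ∈ _
    change X ⊗[ℂ] Y at v
    induction v with
    | zero => exact Submodule.zero_mem _
    | add v w hv hw =>
      have h := Submodule.add_mem _ hv hw
      exact (map_add (X.mι Y) (show X.PreMT Y from v) (show X.PreMT Y from w)).symm ▸ h
    | tmul ξ η => exact key ξ η

/-- The elementary tensor `ξ ⊗ η` as an element of the correspondence `X ⊗ Y`. -/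
noncomputable def ttmul (ξ : X) (η : Y) : X.tensor Y := X.mtmul Y ξ η

lemma ip_ttmul (ξ ξ' : X) (η η' : Y) :
    (X.tensor Y).ip (X.ttmul Y ξ η) (X.ttmul Y ξ' η') = Y.ip η (Y.φ (X.ip ξ ξ') η') :=
  congrArg unop (X.mt_inner_coe Y _ _)

end moduleTensor

section unitary
variable {I P Q : Type*} [NormedAddCommGroup P] [InnerProductSpace ℂ P] [CompleteSpace P]
  [NormedAddCommGroup Q] [InnerProductSpace ℂ Q] [CompleteSpace Q]

lemma denseRange_lc {u : I → P} (hu : (Submodule.span ℂ (Set.range u)).topologicalClosure = ⊤) :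
    DenseRange (Finsupp.linearCombination ℂ u) := by
  rw [← Finsupp.range_linearCombination, ← Submodule.dense_iff_topologicalClosure_eq_top] at hu
  exact hu

lemma norm_lc_eq {u : I → P} {v : I → Q} (h : ∀ i j, inner ℂ (u i) (u j) = inner ℂ (v i) (v j))
    (x : I →₀ ℂ) : ‖Finsupp.linearCombination ℂ v x‖ = ‖Finsupp.linearCombination ℂ u x‖ := by
  have : (‖Finsupp.linearCombination ℂ v x‖ ^ 2 : ℂ) = ‖Finsupp.linearCombination ℂ u x‖ ^ 2 := by
    have e1 := inner_self_eq_norm_sq_to_K (𝕜 := ℂ) (Finsupp.linearCombination ℂ v x)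
    have e2 := inner_self_eq_norm_sq_to_K (𝕜 := ℂ) (Finsupp.linearCombination ℂ u x)
    refine e1.symm.trans (.trans ?_ e2)
    simp only [Finsupp.linearCombination_apply, Finsupp.sum, sum_inner, inner_sum, inner_smul_left,
      inner_smul_right, h]
  norm_cast at this
  exact (sq_eq_sq₀ (norm_nonneg _) (norm_nonneg _)).mp this

/-- The unitary `P → Q` with `u i ↦ v i`, for total families with equal Gram matrices. -/
noncomputable def unitaryOfGram (u : I → P) (v : I → Q)
    (hu : (Submodule.span ℂ (Set.range u)).topologicalClosure = ⊤)
    (hv : (Submodule.span ℂ (Set.range v)).topologicalClosure = ⊤)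
    (h : ∀ i j, inner ℂ (u i) (u j) = inner ℂ (v i) (v j)) : P ≃ₗᵢ[ℂ] Q :=
  (LinearEquiv.refl ℂ (I →₀ ℂ)).extendOfIsometry (Finsupp.linearCombination ℂ u)
    (Finsupp.linearCombination ℂ v) (denseRange_lc hu) (denseRange_lc hv) (norm_lc_eq h)

lemma unitaryOfGram_apply (u : I → P) (v : I → Q) (hu hv h) (i : I) :
    unitaryOfGram u v hu hv h (u i) = v i := by
  have := (LinearEquiv.refl ℂ (I →₀ ℂ)).extendOfIsometry_eq (Finsupp.linearCombination ℂ u)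
    (Finsupp.linearCombination ℂ v) (denseRange_lc hu) (denseRange_lc hv) (norm_lc_eq h)
    (Finsupp.single i 1)
  simpa [unitaryOfGram] using this
end unitary

section maps
variable (X Y : CStarCorr.{u, v} M) {H : Type w} [NormedAddCommGroup H] [InnerProductSpace ℂ H]
  [CompleteSpace H] (σ : M →⋆ₙₐ[ℂ] (H →L[ℂ] H))

lemma norm_tmul_le (ξ : X) (h : H) : ‖X.tmul σ ξ h‖ ≤ ‖ξ‖ * ‖h‖ := by
  refine le_of_sq_le_sq ?_ (by positivity)
  have h1 : ‖X.tmul σ ξ h‖ ^ 2 = ‖inner ℂ h (σ (X.ip ξ ξ) h)‖ := by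
    rw [← inner_tmul, inner_self_eq_norm_sq_to_K]; simp
  rw [h1]
  calc _ ≤ ‖h‖ * (‖X.ip ξ ξ‖ * ‖h‖) := (norm_inner_le_norm _ _).trans
        (mul_le_mul_of_nonneg_left (((σ _).le_opNorm _).trans (mul_le_mul_of_nonneg_right
          (NonUnitalStarAlgHom.norm_apply_le σ _) (norm_nonneg _))) (norm_nonneg _))
    _ = _ := by rw [← norm_sq]; ring

/-- The map `(ξ, h) ↦ ξ ⊗ h` as a bounded bilinear map. -/
noncomputable def tmulL : X →L[ℂ] H →L[ℂ] X.HT σ :=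
  LinearMap.mkContinuous₂ (LinearMap.mk₂ ℂ (X.tmul σ) (X.tmul_add_left σ) (X.tmul_smul_left σ)
    (X.tmul_add_right σ) (fun c ξ h => X.tmul_smul_right σ c ξ h)) 1
    fun ξ h => by simpa using X.norm_tmul_le σ ξ h

@[simp] lemma tmulL_apply (ξ : X) (h : H) : X.tmulL σ ξ h = X.tmul σ ξ h := rfl

lemma HT_total {S : Submodule ℂ (X.HT σ)} (hS : IsClosed (S : Set (X.HT σ)))
    (h : ∀ ξ g, X.tmul σ ξ g ∈ S) : S = ⊤ := by
  refine eq_top_iff.mpr fun x _ => (X.denseRange_ι σ).induction_on x hS fun v => ?_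
  induction v with
  | zero => simp
  | add v w hv hw => rw [map_add]; exact S.add_mem hv hw
  | tmul ξ g => exact h ξ g

lemma MT_total {S : Submodule ℂ (X.tensor Y)} (hS : IsClosed (S : Set (X.tensor Y)))
    (h : ∀ ξ η, X.ttmul Y ξ η ∈ S) : S = ⊤ := by
  refine eq_top_iff.mpr fun x _ => (X.denseRange_mι Y).induction_on x hS fun v => ?_
  change X ⊗[ℂ] Y at v
  induction v with
  | zero => exact S.zero_mem
  | add v w hv hw =>
    exact (map_add (X.mι Y) (show X.PreMT Y from v) (show X.PreMT Y from w)).symm ▸ S.add_mem hv hw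
  | tmul ξ η => exact h ξ η

lemma total_right : (Submodule.span ℂ (Set.range fun p : X × Y × H =>
    X.tmul (Y.indRep σ) p.1 (Y.tmul σ p.2.1 p.2.2))).topologicalClosure = ⊤ := by
  set S := (Submodule.span ℂ (Set.range fun p : X × Y × H =>
    X.tmul (Y.indRep σ) p.1 (Y.tmul σ p.2.1 p.2.2)))
  refine X.HT_total _ S.isClosed_topologicalClosure fun ξ k => ?_
  have : S.topologicalClosure.comap (X.tmulL (Y.indRep σ) ξ).toLinearMap = ⊤ :=
    Y.HT_total _ (S.isClosed_topologicalClosure.preimage (X.tmulL (Y.indRep σ) ξ).continuous)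
      fun η h => S.le_topologicalClosure (Submodule.subset_span ⟨(ξ, η, h), rfl⟩)
  exact (Submodule.eq_top_iff'.mp this) k

lemma total_left : (Submodule.span ℂ (Set.range fun p : X × Y × H =>
    (X.tensor Y).tmul σ (X.ttmul Y p.1 p.2.1) p.2.2)).topologicalClosure = ⊤ := by
  set S := (Submodule.span ℂ (Set.range fun p : X × Y × H =>
    (X.tensor Y).tmul σ (X.ttmul Y p.1 p.2.1) p.2.2))
  refine (X.tensor Y).HT_total _ S.isClosed_topologicalClosure fun m h => ?_
  have : S.topologicalClosure.comap ((((X.tensor Y).tmulL σ).flip h).toLinearMap) = ⊤ :=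
    X.MT_total Y (S.isClosed_topologicalClosure.preimage (((X.tensor Y).tmulL σ).flip h).continuous)
      fun ξ η => S.le_topologicalClosure (Submodule.subset_span ⟨(ξ, η, h), rfl⟩)
  exact (Submodule.eq_top_iff'.mp this) m

/-- The canonical identification `(X ⊗ Y) ⊗_σ H = X ⊗ (Y ⊗_σ H)`. -/
noncomputable def assoc : (X.tensor Y).HT σ ≃ₗᵢ[ℂ] X.HT (Y.indRep σ) :=
  unitaryOfGram (fun p : X × Y × H => (X.tensor Y).tmul σ (X.ttmul Y p.1 p.2.1) p.2.2)
    (fun p : X × Y × H => X.tmul (Y.indRep σ) p.1 (Y.tmul σ p.2.1 p.2.2))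
    (X.total_left Y σ) (X.total_right Y σ) (by
      rintro ⟨ξ, η, h⟩ ⟨ξ', η', h'⟩
      simp only [inner_tmul, indRep_tmul, ip_ttmul])

@[simp] lemma assoc_tmul (ξ : X) (η : Y) (h : H) :
    X.assoc Y σ ((X.tensor Y).tmul σ (X.ttmul Y ξ η) h) =
      X.tmul (Y.indRep σ) ξ (Y.tmul σ η h) :=
  unitaryOfGram_apply _ _ _ _ _ (ξ, η, h)

end maps

/-- An isomorphism of correspondences: a linear bijection that preserves the `M`-valued inner
product (a unitary) and both actions of `M`. -/
structure Iso (X Y : CStarCorr.{u, v} M) where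
  toEquiv : X ≃ₗ[ℂ] Y
  map_ip : ∀ x y, Y.ip (toEquiv x) (toEquiv y) = X.ip x y
  map_left : ∀ (a : M) x, toEquiv (X.φ a x) = Y.φ a (toEquiv x)
  map_right : ∀ (a : M) x, toEquiv (X.ra x a) = Y.ra (toEquiv x) a

namespace Iso
variable {X Y : CStarCorr.{u, v} M}

/-- The identity isomorphism. -/
def refl (X : CStarCorr.{u, v} M) : Iso X X := ⟨.refl ℂ X, by simp, by simp, by simp⟩

/-- The inverse isomorphism. -/
def symm (t : Iso X Y) : Iso Y X where
  toEquiv := t.toEquiv.symm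
  map_ip x y := by rw [← t.map_ip]; simp
  map_left a x := by rw [LinearEquiv.symm_apply_eq, t.map_left]; simp
  map_right a x := by rw [LinearEquiv.symm_apply_eq, t.map_right]; simp

variable {H : Type w} [NormedAddCommGroup H] [InnerProductSpace ℂ H]
  [CompleteSpace H] (σ : M →⋆ₙₐ[ℂ] (H →L[ℂ] H))

lemma HT_span (X : CStarCorr.{u, v} M) : (Submodule.span ℂ (Set.range fun p : X × H =>
    X.tmul σ p.1 p.2)).topologicalClosure = ⊤ :=
  X.HT_total _ (Submodule.isClosed_topologicalClosure _) fun ξ h =>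
    Submodule.le_topologicalClosure _ (Submodule.subset_span ⟨(ξ, h), rfl⟩)

/-- The unitary `t ⊗ I_H : X ⊗_σ H → Y ⊗_σ H`. -/
noncomputable def tensorId (t : Iso X Y) : X.HT σ ≃ₗᵢ[ℂ] Y.HT σ :=
  unitaryOfGram (fun p : X × H => X.tmul σ p.1 p.2) (fun p : X × H => Y.tmul σ (t.toEquiv p.1) p.2)
    (HT_span σ X) (by
      rw [← HT_span σ Y]
      congr 2
      ext z
      exact ⟨fun ⟨p, hp⟩ => ⟨(t.toEquiv p.1, p.2), hp⟩,
        fun ⟨p, hp⟩ => ⟨(t.toEquiv.symm p.1, p.2), by simpa using hp⟩⟩)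
    (fun p q => by rw [inner_tmul, inner_tmul, t.map_ip])

@[simp] lemma tensorId_tmul (t : Iso X Y) (x : X) (h : H) :
    t.tensorId σ (X.tmul σ x h) = Y.tmul σ (t.toEquiv x) h :=
  unitaryOfGram_apply _ _ _ _ _ (x, h)

/-- For `t : X ⊗ Y → Y ⊗ X`, the unitary `t ⊗ I_H : X ⊗ (Y ⊗ H) → Y ⊗ (X ⊗ H)`. -/
noncomputable def flipId (t : Iso (X.tensor Y) (Y.tensor X)) :
    X.HT (Y.indRep σ) ≃ₗᵢ[ℂ] Y.HT (X.indRep σ) :=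
  (X.assoc Y σ).symm.trans ((t.tensorId σ).trans (Y.assoc X σ))

end Iso

section sqrt_approx
variable {D : Type*} [NonUnitalCStarAlgebra D] [PartialOrder D] [StarOrderedRing D]

/-- Approximate factorisation through the square root `y` of a positive element `x`. -/
lemma exists_approx_factor {x : D} (hx : 0 ≤ x) : ∃ y : D, x = star y * y ∧
    ∀ δ : ℝ, 0 < δ → ∃ z : D, ‖star z * x * z‖ ≤ 1 ∧
      ‖x - x * (z * y) - star (z * y) * x + star (z * y) * x * (z * y)‖ ≤ δ := by
  have hsa : IsSelfAdjoint x := hx.isSelfAdjoint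
  have hq : ∀ t ∈ quasispectrum ℝ x, 0 ≤ t := quasispectrum_nonneg_of_nonneg x hx
  have hy : star (cfcₙ Real.sqrt x) = cfcₙ Real.sqrt x := (cfcₙ_predicate Real.sqrt x)
  have hid : cfcₙ (fun t : ℝ => t) x = x := cfcₙ_id' ℝ x
  refine ⟨cfcₙ Real.sqrt x, ?_, fun δ hδ => ?_⟩
  · rw [hy, ← cfcₙ_mul Real.sqrt Real.sqrt x]
    conv_lhs => rw [← hid]
    exact cfcₙ_congr fun t ht => (Real.mul_self_sqrt (hq t ht)).symm
  · set f : ℝ → ℝ := fun t => √t / (t + δ) with hf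
    have hpos : ∀ t ∈ quasispectrum ℝ x, t + δ ≠ 0 := fun t ht => by linarith [hq t ht]
    have hfc : ContinuousOn f (quasispectrum ℝ x) :=
      Real.continuous_sqrt.continuousOn.div (by fun_prop) hpos
    have hf0 : f 0 = 0 := by simp [hf]
    have hz : star (cfcₙ f x) = cfcₙ f x := cfcₙ_predicate f x
    have e1 : cfcₙ f x * cfcₙ Real.sqrt x = cfcₙ (fun t => f t * √t) x :=
      (cfcₙ_mul f Real.sqrt x hfc hf0).symm
    have e1' : star (cfcₙ (fun t => f t * √t) x) =
        cfcₙ (fun t => f t * √t) x := cfcₙ_predicate (fun t => f t * √t) x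
    have hgc : ContinuousOn (fun t => f t * √t) (quasispectrum ℝ x) :=
      hfc.mul Real.continuous_sqrt.continuousOn
    refine ⟨cfcₙ f x, ?_, ?_⟩
    · have : star (cfcₙ f x) * x * cfcₙ f x = cfcₙ (fun t => f t * t * f t) x := by
        rw [hz, cfcₙ_mul (fun t => f t * t) f x (hfc.mul continuousOn_id) (by simp) hfc hf0,
          cfcₙ_mul f (fun t => t) x hfc hf0, hid]
      rw [this]
      refine norm_cfcₙ_le fun t ht => ?_
      have h0 := hq t ht
      have : f t * t * f t = (t / (t + δ)) ^ 2 := by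
        simp only [hf]
        field_simp
        rw [Real.sq_sqrt h0]; ring
      rw [this, Real.norm_of_nonneg (by positivity)]
      have : t / (t + δ) ≤ 1 := (div_le_one (by positivity)).mpr (by linarith)
      exact pow_le_one₀ (by positivity) this
    · rw [e1, e1']
      set g : ℝ → ℝ := fun t => f t * √t with hg
      have hg0 : g 0 = 0 := by simp [hg]
      have : x - x * cfcₙ g x - cfcₙ g x * x + cfcₙ g x * x * cfcₙ g x =
          cfcₙ (fun t => t - t * g t - g t * t + g t * t * g t) x := by
        have c1 : ContinuousOn (fun t => t * g t) (quasispectrum ℝ x) := continuousOn_id.mul hgc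
        have c2 : ContinuousOn (fun t => g t * t) (quasispectrum ℝ x) := hgc.mul continuousOn_id
        have c3 : ContinuousOn (fun t => g t * t * g t) (quasispectrum ℝ x) := c2.mul hgc
        rw [cfcₙ_add (fun t => t - t * g t - g t * t) _ x ((continuousOn_id.sub c1).sub c2)
            (by simp) c3 (by simp),
          cfcₙ_sub (fun t => t - t * g t) _ x (continuousOn_id.sub c1) (by simp) c2 (by simp),
          cfcₙ_sub (fun t => t) _ x continuousOn_id (by simp) c1 (by simp),
          cfcₙ_mul (fun t => g t * t) g x c2 (by simp) hgc hg0,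
          cfcₙ_mul g (fun t => t) x hgc hg0, cfcₙ_mul (fun t => t) g x continuousOn_id rfl hgc hg0,
          hid]
      rw [this]
      refine norm_cfcₙ_le fun t ht => ?_
      have h0 := hq t ht
      have hgt : g t = t / (t + δ) := by
        simp only [hg, hf]
        rw [div_mul_eq_mul_div, Real.mul_self_sqrt h0]
      have : t - t * g t - g t * t + g t * t * g t = t * δ ^ 2 / (t + δ) ^ 2 := by
        rw [hgt]; field_simp; ring
      rw [this, Real.norm_of_nonneg (by positivity), div_le_iff₀ (by positivity)]
      nlinarith [mul_nonneg h0 hδ.le, mul_pos hδ hδ, mul_nonneg (mul_nonneg h0 hδ.le) h0,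
        pow_pos hδ 3, mul_nonneg h0 (sq_nonneg δ)]
end sqrt_approx

section cb
variable {H : Type w} [NormedAddCommGroup H] [InnerProductSpace ℂ H] [CompleteSpace H]

lemma matrix_quad {n : ℕ} (Z : CStarMatrix (Fin n) (Fin n) (H →L[ℂ] H)) (g : Fin n → H) :
    ∑ i, ∑ j, inner ℂ (g i) ((star Z * Z) i j (g j)) = ((∑ k, ‖∑ j, Z k j (g j)‖ ^ 2 : ℝ) : ℂ) := by
  have h (i j) : (star Z * Z) i j = ∑ k, star (Z k i) * Z k j := rfl
  have h2 (k) : ((‖∑ j, Z k j (g j)‖ : ℝ) : ℂ) ^ 2 =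
      ∑ i, ∑ j, inner ℂ (Z k i (g i)) (Z k j (g j)) := by
    refine (inner_self_eq_norm_sq_to_K (𝕜 := ℂ) (∑ j, Z k j (g j))).symm.trans ?_
    simp only [sum_inner, inner_sum]
    exact Finset.sum_comm
  push_cast
  simp only [h, h2, sum_apply, mul_apply_eq_comp, inner_sum,
    ContinuousLinearMap.star_eq_adjoint, ContinuousLinearMap.adjoint_inner_right]
  exact Finset.sum_comm_cycle

/-- A matrix of operators acts on columns with at most its `C*`-norm. -/
lemma matrix_row_le {n : ℕ} (A : CStarMatrix (Fin n) (Fin n) (H →L[ℂ] H)) (g : Fin n → H)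
    (i : Fin n) : ‖∑ j, A i j (g j)‖ ^ 2 ≤ ‖A‖ ^ 2 * ∑ j, ‖g j‖ ^ 2 := by
  have key := CStarAlgebra.star_mul_le_algebraMap_norm_sq (a := A)
  rw [← sub_nonneg] at key
  obtain ⟨Z, hZ⟩ := exists_factor key
  have h1 := matrix_quad Z g
  have h2 := matrix_quad A g
  rw [← hZ] at h1
  have h1 : ∑ i, ∑ j, inner ℂ (g i) (((if i = j then algebraMap ℝ (H →L[ℂ] H) (‖A‖ ^ 2) else 0) -
      (star A * A) i j) (g j)) = ((∑ k, ‖∑ j, Z k j (g j)‖ ^ 2 : ℝ) : ℂ) := h1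
  have e2 (i j) : inner ℂ (g i) ((if i = j then algebraMap ℝ (H →L[ℂ] H) (‖A‖ ^ 2) else 0) (g j))
      = if i = j then ((‖A‖ ^ 2 * ‖g j‖ ^ 2 : ℝ) : ℂ) else 0 := by
    split_ifs with hij
    · subst hij
      have : (algebraMap ℝ (H →L[ℂ] H) (‖A‖ ^ 2)) (g i) = ((‖A‖ ^ 2 : ℝ) : ℂ) • g i := by
        rw [Algebra.algebraMap_eq_smul_one]; rfl
      rw [this, inner_smul_right, inner_self_eq_norm_sq_to_K]
      push_cast; rfl
    · simp
  simp only [sub_apply, inner_sub_right, Finset.sum_sub_distrib, e2,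
    Finset.sum_ite_eq, Finset.mem_univ, if_true] at h1
  rw [h2] at h1
  norm_cast at h1
  rw [← Finset.mul_sum] at h1
  have h3 : ‖∑ j, A i j (g j)‖ ^ 2 ≤ ∑ k, ‖∑ j, A k j (g j)‖ ^ 2 :=
    Finset.single_le_sum (f := fun k => ‖∑ j, A k j (g j)‖ ^ 2) (fun _ _ => by positivity)
      (Finset.mem_univ i)
  have h4 : 0 ≤ ∑ k, ‖∑ j, Z k j (g j)‖ ^ 2 := by positivity
  linarith

/-- Complete boundedness of a linear map `T : X → B(H)`: the amplifications
`M_n(X) → M_n(B(H))` are bounded uniformly in `n`. Here `M_n(X)` carries the norm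
`‖(ξ i j)‖² = ‖(∑ k, ⟨ξ k i, ξ k j⟩)‖` of a correspondence, with the norm of `M_n(M)`. -/
def IsCompletelyBounded (X : CStarCorr.{u, v} M) (T : X →ₗ[ℂ] (H →L[ℂ] H)) : Prop :=
  ∃ C : ℝ, ∀ (n : ℕ) (ξ : Matrix (Fin n) (Fin n) X),
    ‖CStarMatrix.ofMatrix (Matrix.of fun i j => T (ξ i j))‖ ≤
      C * √‖CStarMatrix.ofMatrix (Matrix.of fun i j => ∑ k, X.ip (ξ k i) (ξ k j))‖

/-- Essential (nondegenerate) representations. -/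
def IsEssential (σ : M →⋆ₙₐ[ℂ] (H →L[ℂ] H)) : Prop :=
  (Submodule.span ℂ {z | ∃ (a : M) (h : H), σ a h = z}).topologicalClosure = ⊤

lemma IsEssential.eq_zero {σ : M →⋆ₙₐ[ℂ] (H →L[ℂ] H)} (hσ : IsEssential σ) {y : H}
    (h : ∀ a, σ a y = 0) : y = 0 := by
  have h1 : y ∈ (⊤ : Submodule ℂ H)ᗮ := by
    rw [← hσ, Submodule.orthogonal_closure]
    refine (Submodule.mem_orthogonal _ _).mpr fun z hz => ?_
    induction hz using Submodule.span_induction with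
    | mem z hz =>
      obtain ⟨a, g, rfl⟩ := hz
      rw [inner_rep, h, inner_zero_right]
    | zero => simp
    | add z z' _ _ hz hz' => rw [inner_add_left, hz, hz', add_zero]
    | smul c z _ hz => rw [inner_smul_left, hz, mul_zero]
  simpa using h1

lemma IsEssential.ext {σ : M →⋆ₙₐ[ℂ] (H →L[ℂ] H)} (hσ : IsEssential σ) {A B : H →L[ℂ] H}
    (h : ∀ a b, σ a * A * σ b = σ a * B * σ b) : A = B := by
  have h1 (b) (g) : A (σ b g) = B (σ b g) := by
    rw [← sub_eq_zero]
    refine hσ.eq_zero fun a => ?_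
    rw [map_sub, sub_eq_zero]
    exact DFunLike.congr_fun (h a b) g
  have h2 : (⊤ : Submodule ℂ H) ≤ LinearMap.eqLocus A.toLinearMap B.toLinearMap := by
    rw [← hσ]
    refine Submodule.topologicalClosure_minimal _ (Submodule.span_le.mpr ?_)
      (isClosed_eq A.continuous B.continuous)
    rintro _ ⟨a, g, rfl⟩
    exact h1 a g
  ext g
  exact h2 (Submodule.mem_top (x := g))

/-- A completely bounded covariant representation `(σ, T)` of `X` on `H`. -/
structure CBCovRep (X : CStarCorr.{u, v} M) (σ : M →⋆ₙₐ[ℂ] (H →L[ℂ] H)) where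
  T : X →ₗ[ℂ] (H →L[ℂ] H)
  essential : IsEssential σ
  completelyBounded : IsCompletelyBounded X T
  covariant : ∀ (a b : M) (ξ : X), T (X.φ a (X.ra ξ b)) = σ a * T ξ * σ b

namespace CBCovRep
variable {X : CStarCorr.{u, v} M} {σ : M →⋆ₙₐ[ℂ] (H →L[ℂ] H)} (r : CBCovRep X σ)

lemma ra_ra (ξ : X) (a b : M) : X.ra (X.ra ξ a) b = X.ra ξ (a * b) :=
  X.ext_ip fun z => by simp only [ip_ra_right, mul_assoc]

lemma T_left (a : M) (ξ : X) : r.T (X.φ a ξ) = σ a * r.T ξ := by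
  refine r.essential.ext fun c b => ?_
  rw [← r.covariant, φ_ra, ← mul_assoc, ← map_mul σ, ← r.covariant, map_mul X.φ]
  simp only [φ_ra, mul_apply_eq_comp]

lemma T_right (b : M) (ξ : X) : r.T (X.ra ξ b) = r.T ξ * σ b := by
  refine r.essential.ext fun a c => ?_
  rw [← r.covariant, ra_ra, r.covariant, map_mul σ]
  simp only [mul_assoc]

/-- Row estimate from complete boundedness. -/
lemma row_bound : ∃ C : ℝ, 0 ≤ C ∧ ∀ (n : ℕ) (η : Fin n → X) (g : Fin n → H),
    ‖∑ j, r.T (η j) (g j)‖ ≤ C * (√‖X.gram η‖ * √(∑ j, ‖g j‖ ^ 2)) := by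
  obtain ⟨C, hC⟩ := r.completelyBounded
  refine ⟨max C 0, le_max_right _ _, fun n η g => ?_⟩
  rcases n with _ | n
  · simp
  have h1 := hC (n + 1) fun i j => if i = 0 then η j else 0
  have h2 : (CStarMatrix.ofMatrix (Matrix.of fun i j => ∑ k : Fin (n + 1),
      X.ip (if k = 0 then η i else 0) (if k = 0 then η j else 0))) = X.gram η := by
    ext i j
    change ∑ k : Fin (n + 1), X.ip (if k = 0 then η i else 0) (if k = 0 then η j else 0) = _
    rw [Finset.sum_eq_single 0 (fun k _ hk => by simp [hk, ip]) (by simp)]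
    simp [gram_apply]
  rw [h2] at h1
  have h3 := matrix_row_le (CStarMatrix.ofMatrix (Matrix.of fun i j : Fin (n + 1) =>
    r.T (if i = 0 then η j else 0))) g 0
  change ‖∑ j, r.T (if (0 : Fin (n + 1)) = 0 then η j else 0) (g j)‖ ^ 2 ≤ _ at h3
  simp only [if_true] at h3
  have h4 := h1.trans (mul_le_mul_of_nonneg_right (le_max_left C 0) (Real.sqrt_nonneg _))
  refine le_of_sq_le_sq (h3.trans ?_) (by positivity)
  rw [← mul_assoc, mul_pow _ (√(∑ j, _)), Real.sq_sqrt (by positivity)]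
  gcongr

lemma sum_rowMul {n : ℕ} (ξ : Fin n → X) (b : CStarMatrix (Fin n) (Fin n) M) (g : Fin n → H) :
    ∑ j, r.T (X.rowMul ξ b j) (g j) = ∑ i, r.T (ξ i) (∑ j, σ (b i j) (g j)) := by
  simp only [rowMul, map_sum, sum_apply, T_right, mul_apply_eq_comp]
  exact Finset.sum_comm

/-- The algebraic version of the map `ξ ⊗ h ↦ T(ξ) h`. -/
noncomputable def preTilde : X ⊗[ℂ] H →ₗ[ℂ] H :=
  TensorProduct.lift (ContinuousLinearMap.coeLM ℂ ∘ₗ r.T)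

@[simp] lemma preTilde_tmul (ξ : X) (h : H) : r.preTilde (ξ ⊗ₜ h) = r.T ξ h := rfl

lemma gram_sub_rowMul {n : ℕ} (ξ : Fin n → X) (b : CStarMatrix (Fin n) (Fin n) M) :
    X.gram (ξ - X.rowMul ξ b) =
      X.gram ξ - X.gram ξ * b - star b * X.gram ξ + star b * X.gram ξ * b := by
  rw [← gram_rowMul]
  ext i j
  have e1 : (X.gram ξ * b) i j = X.ip (ξ i) (X.rowMul ξ b j) := by
    simp only [gram_apply, rowMul, CStarMatrix.mul_apply, ip_sum_right, ip_ra_right]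
  have e2 : (star b * X.gram ξ) i j = X.ip (X.rowMul ξ b i) (ξ j) := by
    simp only [gram_apply, rowMul, CStarMatrix.mul_apply, ip_sum_left, ip_ra_left,
      CStarMatrix.star_apply]
  change _ = X.gram ξ i j - (X.gram ξ * b) i j - (star b * X.gram ξ) i j +
    X.gram (X.rowMul ξ b) i j
  rw [e1, e2]
  simp only [gram_apply, Pi.sub_apply, ip_sub_left, ip_sub_right]
  abel

/-- Boundedness of `ξ ⊗ h ↦ T(ξ) h` for the norm of `X ⊗_σ H`. -/
lemma preTilde_bound : ∃ C : ℝ, ∀ v, ‖r.preTilde v‖ ≤ C * ‖X.ι σ v‖ := by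
  obtain ⟨C, hC0, hC⟩ := r.row_bound
  refine ⟨C, fun v => ?_⟩
  obtain ⟨n, e, f, rfl⟩ := TensorProduct.exists_sum_tmul_eq v
  obtain ⟨y, hy, happ⟩ := exists_approx_factor (X.gram_nonneg e)
  have hnorm := norm_ι_sum_sq X (σ := σ) e f hy
  have hK : √(∑ k, ‖∑ j, σ (y k j) (f j)‖ ^ 2) = ‖X.ι σ (∑ i, e i ⊗ₜ f i)‖ := by
    rw [← hnorm, Real.sqrt_sq (norm_nonneg _)]
  set K := √(∑ j, ‖f j‖ ^ 2)
  have main (δ : ℝ) (hδ : 0 < δ) : ‖r.preTilde (∑ i, e i ⊗ₜ f i)‖ ≤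
      C * (√δ * K) + C * ‖X.ι σ (∑ i, e i ⊗ₜ f i)‖ := by
    obtain ⟨z, hz1, hz2⟩ := happ δ hδ
    have e1 : r.preTilde (∑ i, e i ⊗ₜ f i) =
        ∑ j, r.T ((e - X.rowMul e (z * y)) j) (f j) +
          ∑ k, r.T (X.rowMul e z k) (∑ j, σ (y k j) (f j)) := by
      have e2 : ∑ k, r.T (X.rowMul e z k) (∑ j, σ (y k j) (f j)) =
          ∑ j, r.T (X.rowMul e (z * y) j) (f j) := by
        rw [sum_rowMul, sum_rowMul]
        refine Finset.sum_congr rfl fun i _ => congrArg _ ?_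
        simp only [CStarMatrix.mul_apply, map_sum, sum_apply, map_mul, mul_apply_eq_comp]
        exact Finset.sum_comm
      rw [e2, ← Finset.sum_add_distrib, map_sum]
      refine Finset.sum_congr rfl fun j _ => ?_
      simp
    rw [e1]
    refine (norm_add_le _ _).trans (add_le_add ((hC _ _ _).trans ?_) ((hC _ _ _).trans ?_))
    · gcongr
      rw [gram_sub_rowMul]
      exact hz2
    · gcongr
      rw [hK, gram_rowMul]
      exact mul_le_of_le_one_left (norm_nonneg _) (Real.sqrt_le_one.mpr hz1)
  have ht : Filter.Tendsto (fun δ : ℝ => C * (√δ * K) + C * ‖X.ι σ (∑ i, e i ⊗ₜ f i)‖)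
      (nhdsWithin 0 (Set.Ioi 0)) (nhds (C * (√0 * K) + C * ‖X.ι σ (∑ i, e i ⊗ₜ f i)‖)) :=
    (Continuous.tendsto (by fun_prop) 0).mono_left nhdsWithin_le_nhds
  simpa using ge_of_tendsto ht (eventually_mem_nhdsWithin.mono main)

/-- The operator `T̃ : X ⊗_σ H → H`, `T̃(ξ ⊗ h) = T(ξ) h`. -/
noncomputable def tilde : X.HT σ →L[ℂ] H := r.preTilde.extendOfNorm (X.ι σ)

@[simp] lemma tilde_tmul (ξ : X) (h : H) : r.tilde (X.tmul σ ξ h) = r.T ξ h :=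
  LinearMap.extendOfNorm_eq (X.denseRange_ι σ) r.preTilde_bound _

lemma tilde_indRep (a : M) (x : X.HT σ) : r.tilde (X.indRep σ a x) = σ a (r.tilde x) := by
  have h : r.tilde ∘L X.indRep σ a = σ a ∘L r.tilde := HT_ext fun ξ g => by
    simp [T_left]
  exact DFunLike.congr_fun h x

lemma tilde_adjoint_indRep (a : M) (h : H) :
    ContinuousLinearMap.adjoint r.tilde (σ a h) =
      X.indRep σ a (ContinuousLinearMap.adjoint r.tilde h) := by
  refine ext_inner_left ℂ fun x => ?_
  rw [ContinuousLinearMap.adjoint_inner_right, ← star_star a, ← inner_rep, ← inner_rep,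
    ContinuousLinearMap.adjoint_inner_right, tilde_indRep]

end CBCovRep

end cb

section subspaces
variable {H : Type w} [NormedAddCommGroup H] [InnerProductSpace ℂ H] [CompleteSpace H]

/-- `σ(M)`-invariance of a subspace. -/
def RepInvariant (σ : M →⋆ₙₐ[ℂ] (H →L[ℂ] H)) (K : Submodule ℂ H) : Prop :=
  ∀ a, ∀ h ∈ K, σ a h ∈ K

namespace CBCovRep
variable {X : CStarCorr.{u, v} M} {σ : M →⋆ₙₐ[ℂ] (H →L[ℂ] H)} (r : CBCovRep X σ)

/-- `(σ, T)`-reducing closed subspaces. -/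
structure IsReducing (K : Submodule ℂ H) : Prop where
  isClosed : IsClosed (K : Set H)
  rep : RepInvariant σ K
  map_mem : ∀ ξ, ∀ h ∈ K, r.T ξ h ∈ K
  map_mem_orthogonal : ∀ ξ, ∀ h ∈ Kᗮ, r.T ξ h ∈ Kᗮ

/-- The subspace `X ⊗ K` of `X ⊗_σ H`. -/
noncomputable def tensorSubspace (_r : CBCovRep X σ) (K : Submodule ℂ H) : Submodule ℂ (X.HT σ) :=
  (Submodule.span ℂ {z | ∃ (ξ : X), ∃ h ∈ K, X.tmul σ ξ h = z}).topologicalClosure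

/-- The subspace `K ⊖ T̃(X ⊗ K)`: the vectors of `K` orthogonal to `T̃(X ⊗ K)`. -/
noncomputable def defect (K : Submodule ℂ H) : Submodule ℂ H :=
  K ⊓ ((r.tensorSubspace K).map r.tilde.toLinearMap)ᗮ

/-- `𝔏_n(W)`, the closed linear span of all vectors `T(ξ_1) ⋯ T(ξ_n) h` with `h ∈ W`. -/
noncomputable def lspan (n : ℕ) (W : Submodule ℂ H) : Submodule ℂ H :=
  (Submodule.span ℂ {z | ∃ (ξ : Fin n → X), ∃ h ∈ W,
    (List.ofFn fun l => r.T (ξ l)).prod h = z}).topologicalClosure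

/-- Wandering subspaces for `(σ, T)`. -/
structure IsWandering (W : Submodule ℂ H) : Prop where
  isClosed : IsClosed (W : Set H)
  rep : RepInvariant σ W
  orthogonal : ∀ n : ℕ, 1 ≤ n → W ⟂ r.lspan n W

/-- `W` is a generating wandering subspace for the restriction of `(σ, T)` to the reducing
subspace `K`. Vectors `T(ξ_1) ⋯ T(ξ_n) h` with `h ∈ W ⊆ K`, norms and inner products are the same
for `(σ, T)` and for its restriction. -/
structure IsGeneratingWanderingOn (K W : Submodule ℂ H) : Prop where
  le : W ≤ K
  wandering : r.IsWandering W
  generating : (⨆ n : ℕ, r.lspan n W).topologicalClosure = K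

end CBCovRep

/-- `𝔏_m(W)` for covariant representations `(σ, T^{(1)}), …, (σ, T^{(n)})` and a multi-index `m`:
the closed linear span of all vectors
`(T^{(1)}(ξ_{1,1}) ⋯ T^{(1)}(ξ_{1,m_1})) ⋯ (T^{(n)}(ξ_{n,1}) ⋯ T^{(n)}(ξ_{n,m_n})) h`
with `h ∈ W`. -/
noncomputable def multiLspan {σ : M →⋆ₙₐ[ℂ] (H →L[ℂ] H)} {n : ℕ} {X : Fin n → CStarCorr.{u, v} M}
    (r : ∀ j, CBCovRep (X j) σ) (m : Fin n → ℕ) (W : Submodule ℂ H) : Submodule ℂ H :=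
  (Submodule.span ℂ {z | ∃ (ξ : ∀ j, Fin (m j) → X j), ∃ h ∈ W,
    (List.ofFn fun j => (List.ofFn fun l => (r j).T (ξ j l)).prod).prod h = z}).topologicalClosure

/-- Wandering subspaces for `(σ, T^{(1)}, …, T^{(n)})`. -/
structure IsMultiWandering {σ : M →⋆ₙₐ[ℂ] (H →L[ℂ] H)} {n : ℕ} {X : Fin n → CStarCorr.{u, v} M}
    (r : ∀ j, CBCovRep (X j) σ) (W : Submodule ℂ H) : Prop where
  isClosed : IsClosed (W : Set H)
  rep : RepInvariant σ W
  orthogonal : ∀ m : Fin n → ℕ, m ≠ 0 → W ⟂ multiLspan r m W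

/-- Generating wandering subspaces for `(σ, T^{(1)}, …, T^{(n)})`: the closed linear span `[W]_T`
of all `𝔏_m(W)` is the whole space. -/
structure IsGeneratingWandering {σ : M →⋆ₙₐ[ℂ] (H →L[ℂ] H)} {n : ℕ}
    {X : Fin n → CStarCorr.{u, v} M} (r : ∀ j, CBCovRep (X j) σ) (W : Submodule ℂ H) : Prop where
  wandering : IsMultiWandering r W
  generating : (⨆ m : Fin n → ℕ, multiLspan r m W).topologicalClosure = ⊤

/-- The generating wandering subspace property. -/
def HasGeneratingWanderingSubspace {σ : M →⋆ₙₐ[ℂ] (H →L[ℂ] H)} {n : ℕ}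
    {X : Fin n → CStarCorr.{u, v} M} (r : ∀ j, CBCovRep (X j) σ) : Prop :=
  ∃ W : Submodule ℂ H, IsGeneratingWandering r W

end subspaces

end CStarCorr

/-- A product system over `ℕ^k`: correspondences `E_1, …, E_k` with isomorphisms
`t_{i,j} : E_i ⊗ E_j → E_j ⊗ E_i`. The `t_{i,j}` with `i > j` determine the others. -/
structure ProductSystem (M : Type u) [NonUnitalCStarAlgebra M] [PartialOrder M] [StarOrderedRing M]
    (k : ℕ) where
  E : Fin k → CStarCorr.{u, v} M
  t : ∀ i j, CStarCorr.Iso ((E i).tensor (E j)) ((E j).tensor (E i))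
  t_self : ∀ i, t i i = CStarCorr.Iso.refl _
  t_symm : ∀ i j, t i j = (t j i).symm

namespace ProductSystem
variable {M : Type u} [NonUnitalCStarAlgebra M] [PartialOrder M] [StarOrderedRing M] {k : ℕ}
  {H : Type w} [NormedAddCommGroup H] [InnerProductSpace ℂ H] [CompleteSpace H]

/-- A completely bounded covariant representation `(σ, T^{(1)}, …, T^{(k)})` of a product system;
the last field is the relation
`T̃^{(i)} (I_{E_i} ⊗ T̃^{(j)}) = T̃^{(j)} (I_{E_j} ⊗ T̃^{(i)}) (t_{i,j} ⊗ I_H)`. -/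
structure CBCovRep (P : ProductSystem.{u, v} M k) (σ : M →⋆ₙₐ[ℂ] (H →L[ℂ] H)) where
  rep : ∀ i, CStarCorr.CBCovRep (P.E i) σ
  commute : ∀ i j (x : (P.E i).HT ((P.E j).indRep σ)),
    (rep i).tilde ((P.E i).idTensor (rep j).tilde (rep j).tilde_indRep x) =
      (rep j).tilde ((P.E j).idTensor (rep i).tilde (rep i).tilde_indRep ((P.t i j).flipId σ x))

/-- Double commutation:
`T̃^{(j)*} T̃^{(i)} = (I_{E_j} ⊗ T̃^{(i)}) (t_{i,j} ⊗ I_H) (I_{E_i} ⊗ T̃^{(j)*})` for `i ≠ j`. -/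
def CBCovRep.IsDoublyCommuting {P : ProductSystem.{u, v} M k} {σ : M →⋆ₙₐ[ℂ] (H →L[ℂ] H)}
    (r : P.CBCovRep σ) : Prop :=
  ∀ i j, i ≠ j → ∀ x : (P.E i).HT σ,
    ContinuousLinearMap.adjoint (r.rep j).tilde ((r.rep i).tilde x) =
      (P.E j).idTensor (r.rep i).tilde (r.rep i).tilde_indRep
        ((P.t i j).flipId σ
          ((P.E i).idTensor (ContinuousLinearMap.adjoint (r.rep j).tilde)
            (r.rep j).tilde_adjoint_indRep x))

end ProductSystem

/-! The candidate is the joint kernel of the adjoints `T̃^{(α_j)*}`, that is, the set of vectors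
orthogonal to the ranges of all the `T̃^{(α_j)}`. It is wandering for a soft reason. A nonempty word
has a leftmost letter `T^{(α_j)}(ξ)`, so its values lie in the range of `T̃^{(α_j)}`, which is
orthogonal to the joint kernel. No commutation is involved (`isMultiWandering_jointKer`).

Generation goes by induction on the number of indices (`iSup_multiLspan_jointKer`). Let `K` be the
joint kernel for all indices but the last, and let `i` be the last one. Double commutation shows
that `T^{(i)}(ξ)` maps `K` into itself (`T_mem_ker_adjoint`). The commutation relation of the
representation shows that `T^{(i)}(ξ)*` does so too (`adjoint_T_mem_ker_adjoint`), which is the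
invariance of `Kᗮ`. Hence `K` is reducing for `T^{(i)}` (`isReducing_jointKer`), and the hypothesis
on single representations applies to it: `K ⊖ T̃^{(i)}(E_i ⊗ K)` generates `K` under words in
`T^{(i)}`. Since `K` is reducing, this defect space equals `K ∩ ker T̃^{(i)*}`
(`IsReducing.defect_eq`), which is the joint kernel for all the indices. By induction, words in the
earlier indices applied to `K` span a dense subspace of `H`. Placing the words in `T^{(i)}` to their
right shows that the full joint kernel generates `H`. -/

namespace CStarCorr
variable {M : Type u} [NonUnitalCStarAlgebra M] [PartialOrder M] [StarOrderedRing M]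
  {H : Type w} [NormedAddCommGroup H] [InnerProductSpace ℂ H] [CompleteSpace H]

/-! ### One covariant representation: kernel of `T̃*`, defect spaces and words. -/

namespace CBCovRep
variable {X : CStarCorr.{u, v} M} {σ : M →⋆ₙₐ[ℂ] (H →L[ℂ] H)} (r : CBCovRep X σ)

/-- The kernel of `T̃*` is the orthogonal complement of the range of `T̃`, and elementary tensors
are total in `X ⊗_σ H`. Testing on `T(ξ) g` therefore suffices, and later arguments can avoid the
completed tensor product. -/
lemma mem_ker_adjoint_tilde {h : H} :
    h ∈ (ContinuousLinearMap.adjoint r.tilde).ker ↔ ∀ ξ g, inner ℂ (r.T ξ g) h = 0 := by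
  rw [LinearMap.mem_ker]
  constructor
  · intro hh ξ g
    rw [← tilde_tmul, ← ContinuousLinearMap.adjoint_inner_right]
    exact (congrArg _ hh).trans (inner_zero_right _)
  · intro hh
    have : (innerSL ℂ h) ∘L r.tilde = 0 := HT_ext fun ξ g => by
      simpa [inner_eq_zero_symm] using hh ξ g
    refine ext_inner_left ℂ fun x => ?_
    have hx := DFunLike.congr_fun this x
    simp only [ContinuousLinearMap.comp_apply, innerSL_apply_apply,
      zero_apply] at hx
    change inner ℂ x (ContinuousLinearMap.adjoint r.tilde h) = _
    rw [ContinuousLinearMap.adjoint_inner_right, inner_zero_right, inner_eq_zero_symm, hx]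

/-- Arbitrary `x` is needed because the flip `t_{i,j} ⊗ I_H` need not send elementary tensors to
elementary tensors. -/
lemma inner_tilde_eq_zero {h : H} (hh : h ∈ (ContinuousLinearMap.adjoint r.tilde).ker)
    (x : X.HT σ) : inner ℂ (r.tilde x) h = 0 := by
  rw [← ContinuousLinearMap.adjoint_inner_right]
  exact (congrArg _ (LinearMap.mem_ker.mp hh)).trans (inner_zero_right _)

lemma mem_defect {K : Submodule ℂ H} {h : H} :
    h ∈ r.defect K ↔ h ∈ K ∧ ∀ ξ, ∀ g ∈ K, inner ℂ (r.T ξ g) h = 0 := by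
  rw [defect, Submodule.mem_inf, Submodule.mem_orthogonal]
  refine and_congr_right fun _ => ⟨fun hh ξ g hg => ?_, fun hh => ?_⟩
  · rw [← tilde_tmul]
    exact hh _ (Submodule.mem_map_of_mem
      (Submodule.le_topologicalClosure _ (Submodule.subset_span ⟨ξ, g, hg, rfl⟩)))
  · rintro _ ⟨x, hx, rfl⟩
    -- The functional `x ↦ ⟨h, T̃ x⟩` is continuous, so its kernel is closed and only the spanning
    -- vectors `ξ ⊗ g` with `g ∈ K` have to be checked.
    have hle : r.tensorSubspace K ≤ ((innerSL ℂ h) ∘L r.tilde).ker := by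
      refine Submodule.topologicalClosure_minimal _ (Submodule.span_le.mpr ?_)
        (ContinuousLinearMap.isClosed_ker _)
      rintro _ ⟨ξ, g, hg, rfl⟩
      simpa [inner_eq_zero_symm] using hh ξ g hg
    have := hle hx
    rw [inner_eq_zero_symm]
    simpa using this

lemma defect_top : r.defect ⊤ = (ContinuousLinearMap.adjoint r.tilde).ker := by
  ext h
  rw [mem_defect, mem_ker_adjoint_tilde]
  simp

/-- A vector of `K` orthogonal to `T(ξ) K` is automatically orthogonal to `T(ξ) Kᗮ`, because the
latter lies in `Kᗮ`. Splitting `H = K ⊕ Kᗮ` makes it orthogonal to the whole range of `T̃`. -/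
lemma IsReducing.defect_eq {K : Submodule ℂ H} (hK : r.IsReducing K) :
    r.defect K = K ⊓ (ContinuousLinearMap.adjoint r.tilde).ker := by
  -- Completeness of `K` provides the orthogonal decomposition of `g` used below.
  have : CompleteSpace K := hK.isClosed.completeSpace_coe
  ext h
  rw [mem_defect, Submodule.mem_inf, mem_ker_adjoint_tilde]
  refine and_congr_right fun hh => ⟨fun h0 ξ g => ?_, fun h0 ξ g _ => h0 ξ g⟩
  obtain ⟨y, hy, z, hz, rfl⟩ := K.exists_add_mem_mem_orthogonal g
  rw [map_add, inner_add_left, h0 ξ y hy,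
    (Submodule.mem_orthogonal' _ _).mp (hK.map_mem_orthogonal ξ z hz) h hh, add_zero]

/-- The operator `T(ξ_1) ⋯ T(ξ_m)` of a word `(ξ_1, …, ξ_m)`. -/
noncomputable def wordOp (p : Σ m : ℕ, Fin m → X) : H →L[ℂ] H :=
  (List.ofFn fun l => r.T (p.2 l)).prod

/-- For orthogonality only the leftmost letter matters, since it puts the range of the word inside
the range of `T̃`. The remaining letters are hidden in `B`. -/
lemma exists_wordOp_eq (p : Σ m : ℕ, Fin m → X) (hp : p.1 ≠ 0) :
    ∃ ξ B, r.wordOp p = r.T ξ * B := by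
  obtain ⟨_ | m, ξ⟩ := p
  · exact absurd rfl hp
  · exact ⟨ξ 0, (List.ofFn fun l : Fin m => r.T (ξ l.succ)).prod, by
      simp [wordOp, List.ofFn_succ]⟩

end CBCovRep

/-! ### Words in several representations, and the joint kernel as a wandering subspace. -/

section multi
variable {σ : M →⋆ₙₐ[ℂ] (H →L[ℂ] H)}

/-- The product of the operators of words in the correspondences `X 0, X 1, …`. -/
noncomputable def multiWordOp {n : ℕ} {X : Fin n → CStarCorr.{u, v} M}
    (r : ∀ j, CBCovRep (X j) σ) (p : ∀ j, Σ m : ℕ, Fin m → X j) : H →L[ℂ] H :=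
  (List.ofFn fun j => (r j).wordOp (p j)).prod

/-- Empty blocks act as the identity, so the leftmost letter is that of the first nonempty block.
The induction strips blocks from the left until that block is reached. -/
lemma exists_multiWordOp_eq {n : ℕ} {X : Fin n → CStarCorr.{u, v} M}
    (r : ∀ j, CBCovRep (X j) σ) (p : ∀ j, Σ m : ℕ, Fin m → X j) (hp : ∃ j, (p j).1 ≠ 0) :
    ∃ j ξ B, multiWordOp r p = (r j).T ξ * B := by
  induction n with
  | zero => exact hp.choose.elim0
  | succ n ih =>
    have hsucc : multiWordOp r p =
        (r 0).wordOp (p 0) * multiWordOp (fun j => r j.succ) fun j => p j.succ := by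
      simp [multiWordOp, List.ofFn_succ]
    by_cases h0 : (p 0).1 = 0
    · have hone : (r 0).wordOp (p 0) = 1 := by
        revert h0
        -- The length is a component of the pair `p 0`; it can be replaced by `0` only once the pair
        -- is a free variable.
        generalize p 0 = q
        rintro h0
        obtain ⟨m, ξ⟩ := q
        obtain rfl : m = 0 := h0
        simp [CBCovRep.wordOp]
      obtain ⟨j, ξ, B, h⟩ := ih (fun j => r j.succ) (fun j => p j.succ) <| by
        obtain ⟨j, hj⟩ := hp
        induction j using Fin.cases with
        | zero => exact absurd h0 hj
        | succ j => exact ⟨j, hj⟩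
      exact ⟨j.succ, ξ, B, by rw [hsucc, hone, one_mul, h]⟩
    · obtain ⟨ξ, B, h⟩ := (r 0).exists_wordOp_eq (p 0) h0
      exact ⟨0, ξ, _, by rw [hsucc, h, mul_assoc]⟩

/-- The last block is the first to act on a vector. This is why the induction for generation removes
the last index rather than the first. -/
lemma multiWordOp_snoc {n : ℕ} {X : Fin (n + 1) → CStarCorr.{u, v} M}
    (r : ∀ j, CBCovRep (X j) σ) (p : ∀ j : Fin n, Σ m : ℕ, Fin m → X j.castSucc)
    (q : Σ m : ℕ, Fin m → X (Fin.last n)) :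
    multiWordOp r (Fin.snoc (α := fun j => Σ m : ℕ, Fin m → X j) p q) =
      multiWordOp (fun j => r j.castSucc) p * (r (Fin.last n)).wordOp q := by
  rw [multiWordOp, List.ofFn_succ', List.concat_eq_append, List.prod_append]
  simp [multiWordOp]

lemma multiWordOp_mem {n : ℕ} {X : Fin n → CStarCorr.{u, v} M}
    (r : ∀ j, CBCovRep (X j) σ) (p : ∀ j, Σ m : ℕ, Fin m → X j) {W : Submodule ℂ H} {h : H}
    (hh : h ∈ W) :
    multiWordOp r p h ∈ (⨆ m : Fin n → ℕ, multiLspan r m W).topologicalClosure :=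
  Submodule.le_topologicalClosure _ <| Submodule.mem_iSup_of_mem (fun j => (p j).1) <|
    Submodule.le_topologicalClosure _ <| Submodule.subset_span ⟨fun j => (p j).2, h, hh, rfl⟩

/-- The joint kernel of the adjoints `T̃^{(j)*}`. -/
noncomputable def jointKer {ι : Type*} {X : ι → CStarCorr.{u, v} M} (r : ∀ j, CBCovRep (X j) σ) :
    Submodule ℂ H :=
  ⨅ j, (ContinuousLinearMap.adjoint (r j).tilde).ker

lemma isClosed_jointKer {ι : Type*} {X : ι → CStarCorr.{u, v} M} (r : ∀ j, CBCovRep (X j) σ) :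
    IsClosed (jointKer r : Set H) := by
  rw [jointKer, Submodule.coe_iInf]
  exact isClosed_iInter fun j => ContinuousLinearMap.isClosed_ker _

/-- Each `T̃^{(j)*}` intertwines `σ` with the induced representation, so its kernel is invariant. -/
lemma repInvariant_jointKer {ι : Type*} {X : ι → CStarCorr.{u, v} M}
    (r : ∀ j, CBCovRep (X j) σ) : RepInvariant σ (jointKer r) := by
  intro a h hh
  rw [jointKer, Submodule.mem_iInf] at hh ⊢
  intro j
  have hj : ContinuousLinearMap.adjoint (r j).tilde h = 0 := hh j
  change ContinuousLinearMap.adjoint (r j).tilde (σ a h) = 0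
  rw [CBCovRep.tilde_adjoint_indRep, hj, map_zero]

/-- This holds for any family of representations over the same `σ`, without commutation: a nonempty
word takes values in the range of some `T̃^{(j)}`. -/
lemma isMultiWandering_jointKer {n : ℕ} {X : Fin n → CStarCorr.{u, v} M}
    (r : ∀ j, CBCovRep (X j) σ) : IsMultiWandering r (jointKer r) where
  isClosed := isClosed_jointKer r
  rep := repInvariant_jointKer r
  orthogonal m hm := by
    rw [Submodule.isOrtho_comm, multiLspan, Submodule.isOrtho_iff_le]
    refine Submodule.topologicalClosure_minimal _ (Submodule.span_le.mpr ?_)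
      (Submodule.isClosed_orthogonal _)
    -- Membership of `h` in the joint kernel is dropped: the values of a nonempty word are
    -- orthogonal to it for every `h`.
    rintro _ ⟨ξ, h, -, rfl⟩
    obtain ⟨j, η, B, hB⟩ := exists_multiWordOp_eq r (fun j => ⟨m j, ξ j⟩)
      (Function.ne_iff.mp hm)
    refine (Submodule.mem_orthogonal' _ _).mpr fun w hw => ?_
    have hw' := (r j).mem_ker_adjoint_tilde.mp ((Submodule.mem_iInf _).mp hw j) η (B h)
    exact (congrArg (fun A : H →L[ℂ] H => inner ℂ (A h) w) hB).trans hw'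

end multi
end CStarCorr

/-! ### Consequences of (double) commutation: reducing joint kernels and generation. -/

namespace ProductSystem.CBCovRep
open CStarCorr
variable {M : Type u} [NonUnitalCStarAlgebra M] [PartialOrder M] [StarOrderedRing M] {k : ℕ}
  {H : Type w} [NormedAddCommGroup H] [InnerProductSpace ℂ H] [CompleteSpace H]
  {P : ProductSystem.{u, v} M k} {σ : M →⋆ₙₐ[ℂ] (H →L[ℂ] H)} (r : P.CBCovRep σ)

/-- In the double commutation relation at `ξ ⊗ h`, the operator applied first on the right side
yields `ξ ⊗ T̃^{(j)*} h = 0`. -/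
lemma T_mem_ker_adjoint (hr : r.IsDoublyCommuting) {i j : Fin k} (hij : i ≠ j) (ξ : P.E i) {h : H}
    (hh : h ∈ (ContinuousLinearMap.adjoint (r.rep j).tilde).ker) :
    (r.rep i).T ξ h ∈ (ContinuousLinearMap.adjoint (r.rep j).tilde).ker := by
  have h0 : ContinuousLinearMap.adjoint (r.rep j).tilde h = 0 := hh
  have h1 := hr i j hij ((P.E i).tmul σ ξ h)
  -- Passing to the bilinear `tmulL` lets the zero travel through the tensor, the flip and `I ⊗
  -- T̃^{(i)}`.
  rw [CStarCorr.CBCovRep.tilde_tmul, idTensor_tmul, h0, ← tmulL_apply, map_zero, map_zero,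
    map_zero] at h1
  exact h1

/-- By the commutation relation, `T^{(i)}(ξ) T^{(j)}(η) g` lies again in the range of `T̃^{(j)}`. So
`T^{(i)}(ξ)` preserves this range, and its adjoint preserves the orthogonal complement. -/
lemma adjoint_T_mem_ker_adjoint {i j : Fin k} (ξ : P.E i) {h : H}
    (hh : h ∈ (ContinuousLinearMap.adjoint (r.rep j).tilde).ker) :
    ContinuousLinearMap.adjoint ((r.rep i).T ξ) h ∈
      (ContinuousLinearMap.adjoint (r.rep j).tilde).ker := by
  rw [CStarCorr.CBCovRep.mem_ker_adjoint_tilde]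
  intro η g
  rw [ContinuousLinearMap.adjoint_inner_right]
  have h1 := r.commute i j ((P.E i).tmul _ ξ ((P.E j).tmul σ η g))
  rw [idTensor_tmul, CStarCorr.CBCovRep.tilde_tmul, CStarCorr.CBCovRep.tilde_tmul] at h1
  rw [h1]
  exact (r.rep j).inner_tilde_eq_zero hh _

/-- Invariance of `Kᗮ` under `T(ξ)` is obtained as invariance of `K` under `T(ξ)*`. Double
commutation enters only in the invariance of `K` itself. -/
lemma isReducing_jointKer (hr : r.IsDoublyCommuting) {ι : Type*} (α : ι → Fin k) {i : Fin k}
    (hi : ∀ j, i ≠ α j) : (r.rep i).IsReducing (jointKer fun j => r.rep (α j)) where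
  isClosed := isClosed_jointKer _
  rep := repInvariant_jointKer _
  map_mem ξ h hh := (Submodule.mem_iInf _).mpr fun j =>
    r.T_mem_ker_adjoint hr (hi j) ξ ((Submodule.mem_iInf _).mp hh j)
  map_mem_orthogonal ξ h hh := by
    refine (Submodule.mem_orthogonal _ _).mpr fun w hw => ?_
    rw [← ContinuousLinearMap.adjoint_inner_left]
    exact (Submodule.mem_orthogonal _ _).mp hh _ ((Submodule.mem_iInf _).mpr fun j =>
      r.adjoint_T_mem_ker_adjoint ξ ((Submodule.mem_iInf _).mp hw j))

/-- Two density statements are chained: earlier words on the larger kernel `K` span `H`, and words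
in the last index on the full joint kernel span `K`. -/
lemma iSup_multiLspan_jointKer (hr : r.IsDoublyCommuting)
    (hgen : ∀ (i : Fin k) (K : Submodule ℂ H), (r.rep i).IsReducing K →
      (r.rep i).IsGeneratingWanderingOn K ((r.rep i).defect K))
    {n : ℕ} (α : Fin n → Fin k) (hα : Function.Injective α) :
    (⨆ m : Fin n → ℕ, multiLspan (fun j => r.rep (α j)) m
      (jointKer fun j => r.rep (α j))).topologicalClosure = ⊤ := by
  induction n with
  | zero =>
    -- With no indices the joint kernel is all of `H`, and the empty word is the identity.
    refine eq_top_iff.mpr fun h _ => ?_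
    have hmem : h ∈ jointKer fun j : Fin 0 => r.rep (α j) :=
      (Submodule.mem_iInf _).mpr fun j => j.elim0
    simpa [multiWordOp] using
      multiWordOp_mem (fun j => r.rep (α j)) (fun j => j.elim0) hmem
  | succ n ih =>
    set K := jointKer fun j : Fin n => r.rep (α j.castSucc)
    have hK : (r.rep (α (Fin.last n))).IsReducing K :=
      r.isReducing_jointKer hr (fun j : Fin n => α j.castSucc) fun j hj =>
        (Fin.castSucc_lt_last j).ne' (hα hj)
    have hdef : (r.rep (α (Fin.last n))).defect K = jointKer fun j => r.rep (α j) := by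
      rw [hK.defect_eq]
      ext h
      simp only [K, jointKer, Submodule.mem_inf, Submodule.mem_iInf, Fin.forall_fin_succ']
    have hgenK := (hgen _ K hK).generating
    rw [hdef] at hgenK
    have hprev := ih (fun j => α j.castSucc) (hα.comp (Fin.castSucc_injective n))
    -- Writing `⊤` as the closed span from the induction hypothesis leaves only vectors `A y`, with
    -- `y ∈ K` and `A` a word in the earlier indices.
    rw [← top_le_iff, ← hprev]
    set S := (⨆ m : Fin (n + 1) → ℕ, multiLspan (fun j => r.rep (α j)) m
      (jointKer fun j => r.rep (α j))).topologicalClosure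
    have hS : IsClosed (S : Set H) := Submodule.isClosed_topologicalClosure _
    refine Submodule.topologicalClosure_minimal _ (iSup_le fun m => ?_) hS
    refine Submodule.topologicalClosure_minimal _ (Submodule.span_le.mpr ?_) hS
    rintro _ ⟨ξ, y, hy, rfl⟩
    change multiWordOp (fun j : Fin n => r.rep (α j.castSucc)) (fun j => ⟨m j, ξ j⟩) y ∈ S
    set A := multiWordOp (fun j : Fin n => r.rep (α j.castSucc)) (fun j => ⟨m j, ξ j⟩)
    -- The preimage of `S` under the bounded operator `A` is closed, so `y` may be replaced by the
    -- vectors that generate `K`: words in the last index applied to the full joint kernel.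
    suffices hle : K ≤ S.comap A.toLinearMap from hle hy
    have hcl : IsClosed ((S.comap A.toLinearMap : Submodule ℂ H) : Set H) :=
      hS.preimage A.continuous
    rw [← hgenK]
    refine Submodule.topologicalClosure_minimal _ (iSup_le fun l => ?_) hcl
    refine Submodule.topologicalClosure_minimal _ (Submodule.span_le.mpr ?_) hcl
    rintro _ ⟨η, h, hh, rfl⟩
    have hmem := multiWordOp_mem (fun j => r.rep (α j))
      (Fin.snoc (α := fun j => Σ m : ℕ, Fin m → P.E (α j)) (fun j => ⟨m j, ξ j⟩) ⟨l, η⟩) hh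
    rw [multiWordOp_snoc] at hmem
    exact hmem

end ProductSystem.CBCovRep

/-! ### The main theorem. -/

theorem theorem4p4 {M : Type u} [NonUnitalCStarAlgebra M] [PartialOrder M] [StarOrderedRing M]
    {k : ℕ} (P : ProductSystem.{u, v} M k)
    {H : Type w} [NormedAddCommGroup H] [InnerProductSpace ℂ H] [CompleteSpace H]
    (σ : M →⋆ₙₐ[ℂ] (H →L[ℂ] H)) (r : P.CBCovRep σ) (hr : r.IsDoublyCommuting)
    (hgen : ∀ (i : Fin k) (K : Submodule ℂ H), (r.rep i).IsReducing K →
      (r.rep i).IsGeneratingWanderingOn K ((r.rep i).defect K))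
    (n : ℕ) (hn : 1 ≤ n) (α : Fin n ↪ Fin k) :
    CStarCorr.HasGeneratingWanderingSubspace (fun j => r.rep (α j)) ∧
    CStarCorr.IsGeneratingWandering (fun j => r.rep (α j)) (⨅ j, (r.rep (α j)).defect ⊤) ∧
    (⨅ j, (r.rep (α j)).defect ⊤) =
      ⨅ j, (ContinuousLinearMap.adjoint (r.rep (α j)).tilde).ker := by
  have heq : (⨅ j, (r.rep (α j)).defect ⊤) =
      ⨅ j, (ContinuousLinearMap.adjoint (r.rep (α j)).tilde).ker :=
    iInf_congr fun j => (r.rep (α j)).defect_top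
  have hW : CStarCorr.IsGeneratingWandering (fun j => r.rep (α j))
      (⨅ j, (r.rep (α j)).defect ⊤) := by
    rw [heq]
    exact ⟨CStarCorr.isMultiWandering_jointKer _, r.iSup_multiLspan_jointKer hr hgen α α.injective⟩
  exact ⟨⟨_, hW⟩, hW, heq⟩
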